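/- Let $n\ge 2$ and $k\ge 0$. Let $P_k^+$ be the set of weights $\hat\lambda=\sum_{i=0}^{n-1}m_i\hat\omega_i$ of $\widehat{\mathfrak{sl}}(n)$ with $m_i\in\mathbb Z_{\ge0}$ and $\sum_i m_i=k$; indices are taken modulo $n$. For $\hat\lambda\in P_k^+$ let $\lambda=(\lambda_1\ge\dots\ge\lambda_{n-1})$ be the partition with $m_i$ columns of length $i$ for $1\le i\le n-1$ (put $\lambda_n=0$), and denote again by $\hat\lambda$ the partition obtained from $\lambda$ by adding $m_0$ columns of length $n$. Put $\hat\lambda^*=\sum_i m_{-i}\hat\omega_i$. **Combinatorial algebra.** Let $K$ be $\mathbb C$ or $\mathbb Z$ and let $K[z]P_k^+$ be the free $K[z]$-module with basis $P_k^+$. Let $a_i$ ($0\le i\le n-1$) be the $K[z]$-linear endomorphism of it sending $\hat\lambda\in P_k^+$ to $z^{\delta_{i,0}}(\hat\lambda+\hat\omega_{i+1}-\hat\omega_i)$ if $\hat\lambda+\hat\omega_{i+1}-\hat\omega_i\in P_k^+$, and to $0$ otherwise. For $0\le r\le n-1$ let $e_r(\mathcal A)=\sum_{|I|=r}\prod^{\circlearrowleft}_{i\in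 I}a_i$, where $I$ runs over the $r$-element subsets of $\mathbb Z/n$ and the product is anticlockwise ordered: cutting the circle at some $g\notin I$, the factors are written in the order $g+n-1,\dots,g+1$, so that $a_{i+1}$ stands to the left of $a_i$. Put $e_n(\mathcal A)=z$ and $e_r(\mathcal A)=0$ for $r<0$ or $r>n$. For a partition $\mu$ with transpose $\mu^t$ let $s_\mu(\mathcal A)=\det\big(e_{\mu^t_i-i+j}(\mathcal A)\big)_{1\le i,j\le\mu_1}$. Let $\mathcal F_{\rm comb}$ (over $K$) be $K[z]P_k^+$ with the $K[z]$-bilinear product determined by $\hat\lambda\circledast\hat\mu=s_{\hat\lambda}(\mathcal A)\hat\mu$ for $\hat\lambda,\hat\mu\in P_k^+$, and let $\langle z-1\rangle=(z-1)\mathcal F_{\rm comb}$. **Verlinde algebra.** Identify the finite part of $\hat\lambda$ with the vector $\big(\lambda_i-\tfrac{|\lambda|}{n}\big)_{i}\in\mathbb R^n$, let $\rho=\big(\tfrac{n+1}2-i\big)_{i}$, $1\le i\le n$, let $(\cdot,\cdot)$ be the standard scalar product, and put $$\mathcal S_{\hat\lambda\hat\sigma}=\frac{e^{\iota\pi n(n-1)/4}}{\sqrt{n(k+n)^{n-1}}}\sum_{w\in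 S_n}(-1)^{\ell(w)}e^{-\frac{2\pi\iota}{k+n}(\sigma+\rho,\,w(\lambda+\rho))},\qquad \mathcal N_{\hat\lambda\hat\mu}^{\hat\nu}=\sum_{\hat\sigma\in P_k^+}\frac{\mathcal S_{\hat\lambda\hat\sigma}\mathcal S_{\hat\mu\hat\sigma}\mathcal S_{\hat\nu^*\hat\sigma}}{\mathcal S_{0\hat\sigma}},$$ where the index $0$ denotes $k\hat\omega_0$. The complex Verlinde algebra $V_k$ is $\mathbb C P_k^+$ with the bilinear fusion product $\hat\lambda*\hat\mu=\sum_{\hat\nu}\mathcal N_{\hat\lambda\hat\mu}^{\hat\nu}\,\hat\nu$, and the integral Verlinde (fusion) algebra is $\mathcal F=\mathbb ZP_k^+\subset V_k$. **Theorem.** 1. The $e_r(\mathcal A)$ commute pairwise, so that the determinants $s_\mu(\mathcal A)$ are well defined, and the product $\circledast$ of $\mathcal F_{\rm comb}$ (over $\mathbb C$) is commutative and associative. The weight $k\hat\omega_0$ is a two-sided unit of $V_k$. 2. The integral span $\mathcal F$ is closed under $*$, and the combinatorial algebra specialises at $z=1$ to the Verlinde algebra: setting $z=1$ in the coefficients,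 $\sum_{\hat\lambda}p_{\hat\lambda}(z)\hat\lambda\mapsto\sum_{\hat\lambda}p_{\hat\lambda}(1)\hat\lambda$, induces isomorphisms of rings $\mathcal F_{\rm comb}/\langle z-1\rangle\cong\mathcal F$ (for $K=\mathbb Z$) and $\mathcal F_{\rm comb}/\langle z-1\rangle\cong V_k$ (for $K=\mathbb C$). 3. For $z=1$, that is, with $a_i$, $e_r(\mathcal A)$, $s_\mu(\mathcal A)$ and $\circledast$ formed on $\mathbb CP_k^+$ with $z$ replaced by $1$, one has $$\hat\lambda*\hat\mu=\hat\lambda\circledast\hat\mu=s_{\hat\lambda}(\mathcal A)\hat\mu=s_\lambda(\mathcal A)\hat\mu\qquad\text{for all }\hat\lambda,\hat\mu\in P_k^+.$$ -/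

import Mathlib

namespace AffineFusion

/-! ## Weights and partitions -/

/-- The dominant integral weights `∑ i, m i • ω̂ᵢ` of level `k` of the affine Lie algebra `ŝl(n)`,
given by their Dynkin labels `m : Fin n → ℕ`; the vertices of the (cyclic) affine Dynkin
diagram are `0, …, n - 1`, and arithmetic in `Fin n` is arithmetic modulo `n`. -/
def Weight (n k : ℕ) : Type := {m : Fin n → ℕ // ∑ i, m i = k}

namespace Weight

variable {n k : ℕ}

instance : DecidableEq (Weight n k) := inferInstanceAs (DecidableEq {m : Fin n → ℕ // ∑ i, m i = k})

instance : Fintype (Weight n k) :=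
  Fintype.subtype (Finset.Nat.antidiagonalTuple n k) fun _ => Finset.Nat.mem_antidiagonalTuple

/-- The weight `k ω̂₀`, whose finite part is `0`. -/
def zero (n k : ℕ) [NeZero n] : Weight n k :=
  ⟨Pi.single 0 k, by simp⟩

/-- The image `flip(m) = m*` under the diagram automorphism fixing vertex `0` and sending `i` to
`n - i` (it induces the dual weight on finite parts). -/
def flip [NeZero n] (m : Weight n k) : Weight n k :=
  ⟨fun i => m.1 (-i), (Equiv.sum_comp (Equiv.neg (Fin n)) m.1).trans m.2⟩

/-- The row lengths of the partition `P(m)` of the finite part of `m`: it has `m i` columns of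
length `i`, `1 ≤ i ≤ n - 1`. Rows are counted from `0`. -/
def row (m : Weight n k) (i : ℕ) : ℕ := ∑ j : Fin n, if i < (j : ℕ) then m.1 j else 0

/-- The row lengths of the partition `P̂(m)`, obtained from `P(m)` by adding `m 0` columns of
length `n`. -/
def affineRow [NeZero n] (m : Weight n k) (i : ℕ) : ℕ := if i < n then m.row i + m.1 0 else 0

theorem row_antitone (m : Weight n k) : Antitone m.row := fun _ _ h =>
  Finset.sum_le_sum fun j _ => by split_ifs <;> omega

theorem affineRow_antitone [NeZero n] (m : Weight n k) : Antitone m.affineRow := fun a b h => by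
  have := m.row_antitone h
  unfold affineRow
  split_ifs <;> omega

end Weight

/-- The Young diagram with row lengths `f 0 ≥ f 1 ≥ … ≥ f (n - 1)` (and at most `n` rows). -/
def diagramOfRows (n : ℕ) (f : ℕ → ℕ) (hf : Antitone f) : YoungDiagram where
  cells := (Finset.range n).sigma (fun i => Finset.range (f i)) |>.map
    (Equiv.sigmaEquivProd ℕ ℕ).toEmbedding
  isLowerSet := by
    rintro ⟨a, b⟩ ⟨c, d⟩ hle h
    have h1 : c ≤ a := hle.1
    have h2 : d ≤ b := hle.2
    have h3 := hf h1
    simp at h ⊢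
    omega

/-- The Young diagram of the finite part of a weight, `P(m)`. -/
def Weight.diagram {n k : ℕ} (m : Weight n k) : YoungDiagram :=
  diagramOfRows n m.row m.row_antitone

/-- The Young diagram `P̂(m)` of the affine weight. -/
def Weight.affineDiagram {n k : ℕ} [NeZero n] (m : Weight n k) : YoungDiagram :=
  diagramOfRows n m.affineRow m.affineRow_antitone

/-! ## The affine local plactic generators and the noncommutative symmetric polynomials

Everything is done over a commutative ring `R` with a chosen element `z`; the free `R`-module
on the weights of level `k` is `Weight n k → R`, with basis `Pi.single m 1`. -/

section Operators

variable (n k : ℕ) [NeZero n] {R : Type} [CommRing R] (z : R)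

/-- The plactic generator `aᵢ`: it sends the basis vector `m` to `m + ω̂ᵢ₊₁ - ω̂ᵢ` if that is a
dominant weight and to `0` otherwise, multiplied by `z` if `i = 0` (indices modulo `n`). -/
def hop (i : Fin n) : Module.End R (Weight n k → R) :=
  Matrix.toLin' (Matrix.of fun p m : Weight n k =>
    if p.1 + Pi.single i 1 = m.1 + Pi.single (i + 1) 1 then (if i = 0 then z else 1) else 0)

/-- A vertex not in `I`, if there is one. -/
def gap {n : ℕ} [NeZero n] (I : Finset (Fin n)) : Fin n :=
  if h : Iᶜ.Nonempty then Iᶜ.min' h else 0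

/-- The anticlockwise cyclically ordered product of the `aᵢ`, `i ∈ I`, for a proper subset `I` of
the vertices: if `i` and `i + 1` are both in `I`, then `aᵢ₊₁` stands to the left of `aᵢ`. The
circle is cut at a vertex `g ∉ I` and the factors are written in the order
`g + (n - 1), …, g + 1`. -/
def cyclicProd (I : Finset (Fin n)) : Module.End R (Weight n k → R) :=
  (((((List.finRange n).reverse.map fun j => gap I + j).filter fun i => i ∈ I)).map
    fun i => hop n k z i).prod

/-- The cyclic noncommutative elementary symmetric polynomial `e_r(a₀, …, aₙ₋₁)`, with `e₀ = 1`,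
`eₙ = z` and `e_r = 0` for `r < 0` or `r > n`. -/
def elem : ℤ → Module.End R (Weight n k → R)
  | Int.ofNat r =>
      if r = n then z • 1 else ∑ I ∈ Finset.univ.powersetCard r, cyclicProd n k z I
  | Int.negSucc _ => 0

/-- The cyclic noncommutative Schur polynomial `det (e_{λᵗᵢ - i + j})`, the determinant being
expanded by the Leibniz formula (its entries commute with each other); `Y.colLen i` is
the `i`-th part of the transposed partition, and `Y.rowLen 0` is the number of columns. -/
def schur (Y : YoungDiagram) : Module.End R (Weight n k → R) :=
  ∑ s : Equiv.Perm (Fin (Y.rowLen 0)), ((Equiv.Perm.sign s : ℤˣ) : ℤ) •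
    (List.ofFn fun i => elem n k z ((Y.colLen i : ℤ) - (i : ℤ) + (s i : ℤ))).prod

end Operators

/-! ## The combinatorial fusion algebra -/

/-- The `R`-bilinear product with `m ⊛ p = s_{P̂(m)}(a₀, …, aₙ₋₁) p` for basis vectors `m`, `p`. -/
def combMul (n k : ℕ) [NeZero n] {R : Type} [CommRing R] (z : R) :
    (Weight n k → R) →ₗ[R] Module.End R (Weight n k → R) :=
  ∑ m : Weight n k, (LinearMap.proj m).smulRight (schur n k z m.affineDiagram)

/-- The combinatorial algebra: the free `R`-module on the weights of level `k` with the
product `⊛`. The generic algebra is obtained for `R = K[z]` with `z` the variable. -/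
def CombAlg (n k : ℕ) (R : Type) (_z : R) : Type := Weight n k → R

namespace CombAlg

variable {n k : ℕ} {R : Type} [CommRing R] {z : R}

instance : AddCommGroup (CombAlg n k R z) := inferInstanceAs (AddCommGroup (Weight n k → R))

instance : Module R (CombAlg n k R z) := inferInstanceAs (Module R (Weight n k → R))

/-- The basis vector of `m`. -/
def basis (m : Weight n k) : CombAlg n k R z := (Pi.single m 1 : Weight n k → R)

/-- The coefficient of `f` at the basis vector of `m`. -/
def coeff (f : CombAlg n k R z) (m : Weight n k) : R := (f : Weight n k → R) m

instance [NeZero n] : Mul (CombAlg n k R z) where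
  mul f g := combMul n k z f g

instance [NeZero n] : NonUnitalNonAssocRing (CombAlg n k R z) where
  left_distrib f g h := (combMul n k z f).map_add g h
  right_distrib f g h := (combMul n k z).map_add₂ f g h
  zero_mul g := (combMul n k z).map_zero₂ g
  mul_zero f := (combMul n k z f).map_zero

end CombAlg

/-- The ideal `⟨z - 1⟩` of the generic combinatorial algebra over `K[z]`. -/
noncomputable def idealZSubOne (n k : ℕ) [NeZero n] (K : Type) [CommRing K] :
    TwoSidedIdeal (CombAlg n k (Polynomial K) Polynomial.X) :=
  TwoSidedIdeal.span (Set.range fun f : CombAlg n k (Polynomial K) Polynomial.X =>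
    (Polynomial.X - 1 : Polynomial K) • f)

/-- The specialisation `F_comb / ⟨z - 1⟩`. -/
abbrev CombAlgSpec (n k : ℕ) [NeZero n] (K : Type) [CommRing K] : Type :=
  (idealZSubOne n k K).ringCon.Quotient

/-! ## The Verlinde algebra -/

section Verlinde

variable {n k : ℕ}

/-- The `j`-th coordinate, `0 ≤ j ≤ n - 1`, of `λ + ρ`, where `λ = ∑ⱼ (λⱼ - |λ|/n) εⱼ` is the finite
part of the weight `m` and `ρ = ∑ⱼ ((n+1)/2 - j) εⱼ` with `j` counted from `1`. -/
noncomputable def shifted (m : Weight n k) (j : Fin n) : ℝ :=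
  ((m.row j : ℝ) - (∑ i : Fin n, (m.row i : ℝ)) / n) + (((n : ℝ) + 1) / 2 - ((j : ℝ) + 1))

/-- The modular `S`-matrix, given by the Kac-Peterson formula. -/
noncomputable def modularS (m p : Weight n k) : ℂ :=
  Complex.exp (Complex.I * Real.pi * n * (n - 1) / 4) /
      (Real.sqrt ((n : ℝ) * ((k : ℝ) + n) ^ (n - 1)) : ℂ) *
    ∑ w : Equiv.Perm (Fin n), (((Equiv.Perm.sign w : ℤˣ) : ℤ) : ℂ) *
      Complex.exp (-(2 * Real.pi * Complex.I) / ((k : ℂ) + n) *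
        ((∑ j, shifted p j * shifted m (w⁻¹ j) : ℝ) : ℂ))

/-- The fusion coefficient `N_{m p}^q`, given by the Verlinde formula. -/
noncomputable def fusionCoeff [NeZero n] (m p q : Weight n k) : ℂ :=
  ∑ s : Weight n k,
    modularS m s * modularS p s * modularS q.flip s / modularS (Weight.zero n k) s

/-- The bilinear product with `m ∗ p = ∑ q, N_{m p}^q q` for basis vectors `m`, `p`. -/
noncomputable def fusionMul [NeZero n] (v w : Weight n k → ℂ) : Weight n k → ℂ :=
  fun q => ∑ m, ∑ p, v m * w p * fusionCoeff m p q

theorem fusionMul_add [NeZero n] (u v w : Weight n k → ℂ) :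
    fusionMul u (v + w) = fusionMul u v + fusionMul u w := by
  ext q
  simp only [fusionMul, Pi.add_apply, mul_add, add_mul, Finset.sum_add_distrib]

theorem add_fusionMul [NeZero n] (u v w : Weight n k → ℂ) :
    fusionMul (u + v) w = fusionMul u w + fusionMul v w := by
  ext q
  simp only [fusionMul, Pi.add_apply, add_mul, Finset.sum_add_distrib]

theorem fusionMul_zero [NeZero n] (v : Weight n k → ℂ) : fusionMul v 0 = 0 := by
  ext q
  simp [fusionMul]

theorem zero_fusionMul [NeZero n] (v : Weight n k → ℂ) : fusionMul 0 v = 0 := by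
  ext q
  simp [fusionMul]

end Verlinde

/-- The (complex) Verlinde algebra: the complex vector space with basis the weights of level `k`
and the fusion product `∗`. -/
def VerlindeAlg (n k : ℕ) : Type := Weight n k → ℂ

namespace VerlindeAlg

variable {n k : ℕ}

noncomputable instance : AddCommGroup (VerlindeAlg n k) :=
  inferInstanceAs (AddCommGroup (Weight n k → ℂ))

/-- The basis vector of `m`. -/
def basis (m : Weight n k) : VerlindeAlg n k := (Pi.single m 1 : Weight n k → ℂ)

/-- The coefficient of `v` at the basis vector of `m`. -/
def coeff (v : VerlindeAlg n k) (m : Weight n k) : ℂ := (v : Weight n k → ℂ) m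

noncomputable instance [NeZero n] : Mul (VerlindeAlg n k) where
  mul v w := fusionMul v w

noncomputable instance [NeZero n] : NonUnitalNonAssocRing (VerlindeAlg n k) where
  left_distrib u v w := fusionMul_add u v w
  right_distrib u v w := add_fusionMul u v w
  zero_mul v := zero_fusionMul v
  mul_zero v := fusionMul_zero v

end VerlindeAlg

end AffineFusion

namespace AffineFusion

/-! ### Matrix entries of cyclically ordered products of plactic generators -/

section OperatorEntries

variable {n k : ℕ} [NeZero n] {R : Type} [CommRing R] (z : R)

/-! Both products are diagonalised by the same characters. For a weight σ let yᵢ =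
exp(-2πι(σ+ρ)ᵢ/(k+n)), let a_σ be the antisymmetrised exponential, and let ψ_σ be the functional
with coefficients t^(deg λ̂) a_σ(λ+ρ). At z = tⁿ the functional ψ_σ is a left eigenvector of every
e_r(𝒜), with eigenvalue e_r(ty) (`isLeftEigen_elem`). This is the Pieri rule: multiplying a_σ(λ+ρ)
by e_r(y) adds 1 to r of the coordinates in all ways, and whenever the corresponding product of the
aᵢ kills λ̂, the alternant vanishes because two coordinates coincide or differ by k+n
(`exists_add_eq_or_alt_eq_zero`).

The dual Jacobi–Trudi identity then shows that s_λ̂(𝒜) has eigenvalue ψ_σ(λ̂)/a_σ(ρ), so ψ_σ/a_σ(ρ)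
is multiplicative for ⊛ (`eigenCoeff_dotProduct_combMul`). Unitarity of the S-matrix, a consequence
of the orthogonality `sum_altPair`, makes it multiplicative for ∗ at t = 1
(`eigenCoeff_dotProduct_fusionMul`) and shows that the ψ_σ separate vectors
(`ext_of_eigenCoeff_dotProduct`). Commutativity, associativity, the unit and the equality of ∗ with
⊛ at z = 1 thus become identities between complex numbers.

Generic z follows since every nonzero complex number is some tⁿ and a polynomial is determined by
infinitely many values. All operators are compatible with ring maps, which gives the integral case.
The quotient by z - 1 is evaluation at 1, because a coefficient vanishing at 1 is divisible by z -
1. -/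

theorem hop_apply_single (i : Fin n) (m p : Weight n k) :
    hop n k z i (Pi.single m 1) p =
      if p.1 + Pi.single i 1 = m.1 + Pi.single (i + 1) 1 then (if i = 0 then z else 1) else 0 := by
  simp [hop, Matrix.toLin'_apply]

omit [NeZero n] in
theorem end_apply_eq_sum (T : Module.End R (Weight n k → R)) (v : Weight n k → R)
    (p : Weight n k) : T v p = ∑ q, v q * T (Pi.single q 1) p := by
  conv_lhs => rw [← Finset.univ_sum_single v]
  simp only [map_sum, Finset.sum_apply]
  refine Finset.sum_congr rfl fun q _ => ?_
  have : (Pi.single q (v q) : Weight n k → R) = v q • Pi.single q 1 := by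
    rw [← Pi.single_smul]; simp
  rw [this, map_smul]; simp

theorem fin_add_one_ne (hn : 2 ≤ n) (i : Fin n) : i + 1 ≠ i := by
  obtain ⟨m, rfl⟩ : ∃ m, n = m + 2 := ⟨n - 2, by omega⟩
  simp

/-- The operator `aᵢ₁ ⋯ aᵢᵣ` for a list in which `i + 1` never stands to the right of `i`. -/
theorem hop_list_prod_apply_single (hn : 2 ≤ n) (L : List (Fin n)) (hL : L.Nodup)
    (hord : L.Pairwise fun a b => b ≠ a + 1) (m p : Weight n k) :
    (L.map fun i => hop n k z i).prod (Pi.single m 1) p =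
      if p.1 + (L.map fun i => Pi.single i 1).sum = m.1 + (L.map fun i => Pi.single (i + 1) 1).sum
      then (if 0 ∈ L then z else 1) else 0 := by
  induction L generalizing p with
  | nil =>
    simp only [List.map_nil, List.prod_nil, Module.End.one_apply, List.sum_nil, add_zero,
      List.not_mem_nil, if_false, Pi.single_apply]
    exact if_congr (Subtype.ext_iff) rfl rfl
  | cons i L ih =>
    rw [List.nodup_cons] at hL
    rw [List.pairwise_cons] at hord
    have hsum (j : Fin n) (hj : j ∉ L) : (L.map fun i => (Pi.single i 1 : Fin n → ℕ)).sum j = 0 := by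
      clear ih hL hord
      induction L with
      | nil => simp
      | cons a L ih =>
        simp only [List.mem_cons, not_or] at hj
        simp [ih hj.2, hj.1]
    have hnot : i + 1 ∉ L := fun h => hord.1 _ h rfl
    simp only [List.map_cons, List.prod_cons, Module.End.mul_apply, List.sum_cons]
    rw [end_apply_eq_sum]
    simp only [ih hL.2 hord.2, hop_apply_single]
    have hA := hsum _ hnot
    generalize (L.map fun i => (Pi.single i 1 : Fin n → ℕ)).sum = A at hA ⊢
    generalize (L.map fun i => (Pi.single (i + 1) 1 : Fin n → ℕ)).sum = B
    have hz : (if 0 ∈ L then z else 1) * (if i = 0 then z else 1) = if 0 ∈ i :: L then z else 1 := by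
      by_cases hi : i = 0
      · subst hi; simp [hL.1]
      · simp [hi, Ne.symm hi]
    by_cases h : p.1 + (Pi.single i 1 + A) = m.1 + (Pi.single (i + 1) 1 + B)
    · rw [if_pos h]
      have hne := fin_add_one_ne hn i
      -- Since `i + 1` does not occur in the tail, the tail cannot consume the unit created at `i +
      -- 1`. Hence the truncated subtraction defining the unique intermediate weight is exact.
      have hp : 1 ≤ p.1 (i + 1) := by
        have := congrFun h (i + 1)
        simp [hA, hne] at this
        omega
      have hq : (fun j => p.1 j + (Pi.single i 1 : Fin n → ℕ) j - (Pi.single (i + 1) 1 : Fin n → ℕ) j) +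
          Pi.single (i + 1) 1 = p.1 + Pi.single i 1 := by
        ext j
        by_cases hj : j = i + 1
        · subst hj; simp [hne]; omega
        · simp [hj]
      have hqk : ∑ j, (p.1 j + (Pi.single i 1 : Fin n → ℕ) j - (Pi.single (i + 1) 1 : Fin n → ℕ) j)
          = k := by
        have h1 := congrArg (fun f => ∑ j, f j) hq
        simp only [Pi.add_apply, Finset.sum_add_distrib, Finset.sum_pi_single', Finset.mem_univ,
          if_true, p.2] at h1
        simpa using h1
      rw [Finset.sum_eq_single ⟨_, hqk⟩]
      · rw [if_pos, if_pos hq.symm, hz]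
        have : (Pi.single (i + 1) 1 : Fin n → ℕ) + ((fun j => p.1 j + (Pi.single i 1 : Fin n → ℕ) j -
            (Pi.single (i + 1) 1 : Fin n → ℕ) j) + A) = Pi.single (i + 1) 1 + (m.1 + B) := by
          rw [← add_assoc, add_comm (Pi.single (i + 1) 1), hq, add_assoc, h]
          abel
        exact add_left_cancel this
      · intro q _ hne'
        rw [if_neg (c := p.1 + Pi.single i 1 = _), mul_zero]
        intro h2
        exact hne' (Subtype.ext (add_right_cancel (h2.symm.trans hq.symm)))
      · exact fun h => absurd (Finset.mem_univ _) h
    · rw [if_neg h]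
      refine Finset.sum_eq_zero fun q _ => ?_
      by_cases h1 : q.1 + A = m.1 + B
      · rw [if_neg (c := p.1 + Pi.single i 1 = _), mul_zero]
        intro h2
        apply h
        rw [← add_assoc, h2, add_right_comm, h1]
        abel
      · rw [if_neg h1, zero_mul]

theorem gap_notMem {I : Finset (Fin n)} (hI : I ≠ Finset.univ) : gap I ∉ I := by
  have h : Iᶜ.Nonempty := by
    rw [Finset.nonempty_iff_ne_empty]
    simpa [Finset.compl_eq_empty_iff] using hI
  rw [gap, dif_pos h]
  exact Finset.mem_compl.1 (Finset.min'_mem _ h)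

/-- The matrix entries of the cyclically ordered product over a proper subset. -/
theorem cyclicProd_apply_single (hn : 2 ≤ n) {I : Finset (Fin n)} (hI : I ≠ Finset.univ)
    (m p : Weight n k) :
    cyclicProd n k z I (Pi.single m 1) p =
      if p.1 + ∑ i ∈ I, Pi.single i 1 = m.1 + ∑ i ∈ I, Pi.single (i + 1) 1
      then (if 0 ∈ I then z else 1) else 0 := by
  set L : List (Fin n) := ((List.finRange n).reverse.map fun j => gap I + j).filter fun i => i ∈ I
    with hLdef
  have hg := gap_notMem hI
  have hnd : L.Nodup := by
    refine List.Nodup.filter _ (List.Nodup.map (add_right_injective _) ?_)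
    exact List.nodup_reverse.2 (List.nodup_finRange n)
  have hmem (i : Fin n) : i ∈ L ↔ i ∈ I := by
    simp only [hLdef, List.mem_filter, List.mem_map, List.mem_reverse, List.mem_finRange, true_and,
      decide_eq_true_eq, and_iff_right_iff_imp]
    exact fun _ => ⟨i - gap I, by simp⟩
  have hfin : L.toFinset = I := by ext i; simp [hmem]
  have hord : L.Pairwise fun a b => b ≠ a + 1 := by
    rw [hLdef, List.pairwise_filter, List.pairwise_map, List.pairwise_reverse]
    refine (List.pairwise_lt_finRange n).imp ?_
    intro a b hab _ ha h
    simp only [decide_eq_true_eq] at ha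
    rw [add_assoc, add_right_inj] at h
    obtain ⟨n', rfl⟩ : ∃ n', n = n' + 1 := ⟨n - 1, by omega⟩
    -- Offsets from the gap decrease along the list, so `i + 1` could stand to the right of `i` only
    -- by wrapping around, and then it would be the gap itself.
    by_cases hb : b = Fin.last n'
    · subst hb
      rw [Fin.last_add_one] at h
      rw [h, add_zero] at ha
      exact hg ha
    · have h1 : (b + 1 : Fin (n' + 1)).val = b.val + 1 := by
        rw [Fin.val_add_one, if_neg hb]
      have h2 : a.val < b.val := hab
      rw [h, h1] at h2
      omega
  have hsum (f : Fin n → Fin n → ℕ) : (L.map f).sum = ∑ i ∈ I, f i := by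
    rw [← hfin, List.sum_toFinset _ hnd]
  have := hop_list_prod_apply_single z hn L hnd hord m p
  rw [hsum, hsum] at this
  simp only [hmem] at this
  exact this

end OperatorEntries
end AffineFusion

namespace AffineFusion

/-! ### The dual Jacobi–Trudi identity in bialternant form -/

section JacobiTrudi

open Polynomial

variable {n : ℕ} {R : Type} [CommRing R]

/-- The elementary symmetric polynomials of a finite family, extended by zero to `ℤ`. -/
def esymmInt (y : Fin n → R) : ℤ → R
  | Int.ofNat r => ∑ I ∈ Finset.univ.powersetCard r, ∏ i ∈ I, y i
  | Int.negSucc _ => 0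

theorem esymmInt_natCast (y : Fin n → R) (r : ℕ) :
    esymmInt y r = ∑ I ∈ Finset.univ.powersetCard r, ∏ i ∈ I, y i := rfl

theorem esymmInt_of_neg (y : Fin n → R) {r : ℤ} (hr : r < 0) : esymmInt y r = 0 := by
  cases r with
  | ofNat r => exact absurd hr (by simp)
  | negSucc r => rfl

theorem esymmInt_of_gt (y : Fin n → R) {r : ℤ} (hr : (n : ℤ) < r) : esymmInt y r = 0 := by
  lift r to ℕ using by omega
  rw [esymmInt_natCast, Finset.powersetCard_eq_empty.2 (by simpa using hr), Finset.sum_empty]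

/-- Vieta, for all `a` and `q` at once: the extension of `esymmInt` by zero covers coefficients
outside the support, and the sign exponent `n + a + q` has the parity of `n + a - q` without a
subtraction. -/
theorem coeff_X_pow_mul_prod_X_sub_C (y : Fin n → R) (a q : ℕ) :
    (X ^ a * ∏ i, (X - C (y i))).coeff q = (-1) ^ (n + a + q) * esymmInt y ((n : ℤ) + a - q) := by
  nontriviality R
  rw [coeff_X_pow_mul']
  split_ifs with h
  · rcases le_or_gt (q - a) n with h1 | h1
    · have h2 := Multiset.prod_X_sub_C_coeff (Finset.univ.val.map y) (k := q - a) (by simpa using h1)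
      rw [Finset.esymm_map_val] at h2
      simp only [Multiset.map_map, Function.comp_def, Multiset.card_map, Finset.card_val,
        Finset.card_univ, Fintype.card_fin] at h2
      have h3 : (n : ℤ) + a - q = ((n - (q - a) : ℕ) : ℤ) := by omega
      rw [h3, esymmInt_natCast]
      refine h2.trans ?_
      congr 1
      have : n + a + q = n - (q - a) + 2 * q := by omega
      rw [this, pow_add, pow_mul]; simp
    · rw [esymmInt_of_neg _ (by omega), mul_zero]
      refine coeff_eq_zero_of_natDegree_lt ?_
      rw [natDegree_finsetProd_X_sub_C_eq_card]
      simpa using h1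
  · rw [esymmInt_of_gt _ (by omega), mul_zero]

/-- The data of a partition with `n` rows and `c` columns: `F` gives the row lengths in increasing
order and `col` the column lengths. -/
structure IsConjugate {n c : ℕ} (F : Fin n → ℕ) (col : Fin c → ℕ) : Prop where
  mono : Monotone F
  anti : Antitone col
  le_left : ∀ j, F j ≤ c
  le_right : ∀ i, col i ≤ n
  iff : ∀ (i : Fin c) (j : Fin n), (i : ℕ) < F j ↔ n ≤ col i + j

namespace IsConjugate

variable {c : ℕ} {F : Fin n → ℕ} {col : Fin c → ℕ}

/-- The positions of the vertical and horizontal steps of the boundary path of the partition. -/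
def steps (h : IsConjugate F col) : Fin n ⊕ Fin c → Fin (n + c) :=
  Sum.elim (fun j => ⟨F j + j, by have := h.le_left j; omega⟩)
    (fun i => ⟨n + i - col i, by omega⟩)

/-- A vertical step `j` and a horizontal step `i` never share a position: if the box `(i, j)` is
present, the horizontal step comes strictly first, and otherwise strictly last. -/
theorem steps_injective (h : IsConjugate F col) : Function.Injective h.steps := by
  have h1 (i : Fin c) (j : Fin n) : F j + j ≠ n + i - col i := by
    have := h.iff i j
    have := h.le_right i
    omega
  rintro (a | a) (b | b) hab <;> simp only [steps, Sum.elim_inl, Sum.elim_inr, Fin.mk.injEq] at hab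
  · rcases lt_trichotomy a b with hlt | rfl | hlt
    · have := h.mono hlt.le; have : a.val < b.val := hlt; omega
    · rfl
    · have := h.mono hlt.le; have : b.val < a.val := hlt; omega
  · exact absurd hab (h1 _ _)
  · exact absurd hab.symm (h1 _ _)
  · have := h.le_right a
    have := h.le_right b
    rcases lt_trichotomy a b with hlt | rfl | hlt
    · have := h.anti hlt.le; have : a.val < b.val := hlt; omega
    · rfl
    · have := h.anti hlt.le; have : b.val < a.val := hlt; omega

/-- The boundary path as a bijection. -/
noncomputable def stepsEquiv (h : IsConjugate F col) : Fin n ⊕ Fin c ≃ Fin (n + c) :=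
  Equiv.ofBijective h.steps
    ((Fintype.bijective_iff_injective_and_card _).2 ⟨h.steps_injective, by simp⟩)

/-- The inversions of the boundary path are the pairs of a row and a column whose crossing is a box
of the partition, so the sign is -1 to the number of boxes. -/
theorem sign_stepsEquiv (h : IsConjugate F col) :
    ((Equiv.Perm.sign (finSumFinEquiv.symm.trans h.stepsEquiv) : ℤˣ) : ℤ) =
      ∏ i, (-1) ^ col i := by
  rw [Equiv.Perm.sign_eq_prod_prod_Ioi]
  have hIoi (G : Fin (n + c) → Fin (n + c) → ℤˣ) :
      ∏ i, ∏ j ∈ Finset.Ioi i, G i j = ∏ a : Fin n ⊕ Fin c, ∏ b : Fin n ⊕ Fin c,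
        if finSumFinEquiv a < finSumFinEquiv b then G (finSumFinEquiv a) (finSumFinEquiv b)
        else 1 := by
    rw [← Equiv.prod_comp finSumFinEquiv]
    refine Finset.prod_congr rfl fun a _ => ?_
    rw [Equiv.prod_comp finSumFinEquiv (fun b => if finSumFinEquiv a < b then
      G (finSumFinEquiv a) b else 1), ← Finset.prod_filter]
    refine Finset.prod_congr ?_ fun _ _ => rfl
    ext; simp
  rw [hIoi]
  have e1 (a b : Fin n) : (if finSumFinEquiv (Sum.inl a : Fin n ⊕ Fin c) <
      finSumFinEquiv (Sum.inl b : Fin n ⊕ Fin c) then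
      (if (finSumFinEquiv.symm.trans h.stepsEquiv) (finSumFinEquiv (Sum.inl a)) <
        (finSumFinEquiv.symm.trans h.stepsEquiv) (finSumFinEquiv (Sum.inl b)) then 1 else -1 : ℤˣ)
      else 1) = 1 := by
    rw [ite_eq_right_iff]
    intro hab
    rw [if_pos]
    have hab' : a < b := hab
    have := h.mono hab'.le
    have : a.val < b.val := hab'
    simp [stepsEquiv, steps]
    omega
  have e2 (a b : Fin c) : (if finSumFinEquiv (Sum.inr a : Fin n ⊕ Fin c) <
      finSumFinEquiv (Sum.inr b : Fin n ⊕ Fin c) then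
      (if (finSumFinEquiv.symm.trans h.stepsEquiv) (finSumFinEquiv (Sum.inr a)) <
        (finSumFinEquiv.symm.trans h.stepsEquiv) (finSumFinEquiv (Sum.inr b)) then 1 else -1 : ℤˣ)
      else 1) = 1 := by
    rw [ite_eq_right_iff]
    intro hab
    rw [if_pos]
    have hab' : a < b := by simpa using hab
    have := h.anti hab'.le
    have : a.val < b.val := hab'
    have := h.le_right a
    have := h.le_right b
    simp [stepsEquiv, steps]
    omega
  have e3 (a : Fin c) (b : Fin n) : (if finSumFinEquiv (Sum.inr a : Fin n ⊕ Fin c) <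
      finSumFinEquiv (Sum.inl b : Fin n ⊕ Fin c) then
      (if (finSumFinEquiv.symm.trans h.stepsEquiv) (finSumFinEquiv (Sum.inr a)) <
        (finSumFinEquiv.symm.trans h.stepsEquiv) (finSumFinEquiv (Sum.inl b)) then 1 else -1 : ℤˣ)
      else 1) = 1 := by
    rw [if_neg]
    simp [Fin.lt_def]
    omega
  have e4 (a : Fin n) (b : Fin c) : (if finSumFinEquiv (Sum.inl a : Fin n ⊕ Fin c) <
      finSumFinEquiv (Sum.inr b : Fin n ⊕ Fin c) then
      (if (finSumFinEquiv.symm.trans h.stepsEquiv) (finSumFinEquiv (Sum.inl a)) <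
        (finSumFinEquiv.symm.trans h.stepsEquiv) (finSumFinEquiv (Sum.inr b)) then 1 else -1 : ℤˣ)
      else 1) = if n ≤ col b + a then -1 else 1 := by
    rw [if_pos (by simp [Fin.lt_def]; omega)]
    have := h.iff b a
    have := h.le_right b
    simp only [stepsEquiv, steps, Equiv.trans_apply, Equiv.symm_apply_apply,
      Equiv.ofBijective_apply, Sum.elim_inl, Sum.elim_inr, Fin.mk_lt_mk]
    split_ifs <;> first | rfl | omega
  simp only [Fintype.prod_sum_type]
  simp only [e1, e2, e3, e4, Finset.prod_const_one, one_mul, mul_one]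
  rw [Finset.prod_comm]
  have e5 (i : Fin c) : ∏ j : Fin n, (if n ≤ col i + j then -1 else 1 : ℤˣ) = (-1) ^ col i := by
    rw [← Equiv.prod_comp Fin.revPerm]
    have hrev (j : Fin n) : n ≤ col i + (Fin.revPerm j : ℕ) ↔ (j : ℕ) < col i := by
      simp only [Fin.revPerm_apply, Fin.val_rev]
      omega
    simp only [hrev]
    rw [Fin.prod_univ_eq_prod_range (fun j => if j < col i then (-1 : ℤˣ) else 1),
      ← Finset.prod_filter]
    have : (Finset.range n).filter (fun j => j < col i) = Finset.range (col i) := by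
      have := h.le_right i
      ext; simp; omega
    rw [this, Finset.prod_const, Finset.card_range]
  simp only [e5]
  push_cast
  rfl

/-- The dual Jacobi–Trudi identity, in bialternant form. -/
theorem det_esymmInt_mul_det_pow (h : IsConjugate F col) (y : Fin n → R) :
    (Matrix.of fun i j : Fin c => esymmInt y ((col i : ℤ) - i + j)).det *
      (Matrix.of fun i j : Fin n => y i ^ (j : ℕ)).det =
      (Matrix.of fun i j : Fin n => y i ^ (F j + j)).det := by
  nontriviality R
  set P : R[X] := ∏ i, (X - C (y i)) with hP
  have hPm : P.Monic := monic_prod_X_sub_C _ _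
  have hPdeg : P.natDegree = n := by
    rw [hP, natDegree_finsetProd_X_sub_C_eq_card]; simp
  -- `U` stacks unit rows at the vertical steps on the coefficient rows of the `X ^ a * P`; `V`
  -- places the powers of the `y i` beside the unit columns of index at least `n`. As `P` vanishes
  -- at each `y i`, `U * V` is block triangular, with a transposed alternant and a unitriangular
  -- block on the diagonal. Reordering by the boundary path makes each factor block triangular too:
  -- `U` yields the Jacobi–Trudi determinant, `V` the Vandermonde determinant, with the same sign.
  let U : Matrix (Fin n ⊕ Fin c) (Fin (n + c)) R := Matrix.of fun s q =>
    Sum.elim (fun j => if q = h.stepsEquiv (Sum.inl j) then 1 else 0)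
      (fun a => (X ^ (a : ℕ) * P).coeff q) s
  let V : Matrix (Fin (n + c)) (Fin n ⊕ Fin c) R := Matrix.of fun q s =>
    Sum.elim (fun i => y i ^ (q : ℕ)) (fun b : Fin c => if (q : ℕ) = n + b then 1 else 0) s
  have hdet : (U * V).det = (U.submatrix id h.stepsEquiv).det * (V.submatrix h.stepsEquiv id).det := by
    rw [← Matrix.det_mul, Matrix.submatrix_mul_equiv, Matrix.submatrix_id_id]
  have hUV : (U * V).det = (Matrix.of fun i j : Fin n => y i ^ (F j + j)).det := by
    have h0 : (U * V).toBlocks₂₁ = 0 := by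
      ext a i
      have : (X ^ (a : ℕ) * P).eval (y i) = 0 := by
        rw [eval_mul, hP, eval_prod, Finset.prod_eq_zero (Finset.mem_univ i) (by simp), mul_zero]
      rw [eval_eq_sum_range' (n := n + c) ?_, Finset.sum_range] at this
      · simpa [Matrix.toBlocks₂₁, Matrix.mul_apply, U, V] using this
      · rw [natDegree_X_pow_mul _ hPm.ne_zero, hPdeg]; omega
    rw [← Matrix.fromBlocks_toBlocks (U * V), h0, Matrix.det_fromBlocks_zero₂₁]
    have h1 : (U * V).toBlocks₂₂.det = 1 := by
      have hent (a b : Fin c) : (U * V).toBlocks₂₂ a b = (X ^ (a : ℕ) * P).coeff (n + b) := by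
        have hq (q : Fin (n + c)) : ((q : ℕ) = n + b) ↔ q = ⟨n + b, by omega⟩ := by
          rw [Fin.ext_iff]
        simp [Matrix.toBlocks₂₂, Matrix.mul_apply, U, V, hq]
      rw [Matrix.det_of_isLowerTriangular]
      · refine Finset.prod_eq_one fun a _ => ?_
        rw [hent, coeff_X_pow_mul', if_pos (by omega), Nat.add_sub_cancel]
        have := hPm.coeff_natDegree
        rwa [hPdeg] at this
      · intro a b hab
        have hab' : a.val < b.val := hab
        rw [hent, coeff_X_pow_mul', if_pos (by omega)]
        exact coeff_eq_zero_of_natDegree_lt (by omega)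
    rw [h1, mul_one, ← Matrix.det_transpose]
    congr 1
    ext i j
    simp [Matrix.toBlocks₁₁, Matrix.mul_apply, U, V, stepsEquiv, steps]
  have hU : (U.submatrix id h.stepsEquiv).det =
      (∏ i, (-1) ^ col i) * (Matrix.of fun i j : Fin c => esymmInt y ((col i : ℤ) - i + j)).det := by
    have : U.submatrix id h.stepsEquiv = Matrix.fromBlocks 1 0
        (Matrix.of fun a j => U (Sum.inr a) (h.stepsEquiv (Sum.inl j)))
        (Matrix.of fun a i => U (Sum.inr a) (h.stepsEquiv (Sum.inr i))) := by
      ext (a | a) (b | b)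
      · simp [U, Matrix.one_apply, eq_comm]
      · simp [U]
      · simp
      · simp
    rw [this, Matrix.det_fromBlocks_zero₁₂, Matrix.det_one, one_mul, ← Matrix.det_transpose]
    -- The Vieta signs split into row signs `(-1) ^ (col i + i)` and column signs `(-1) ^ a`; the
    -- parts in `i` and in `a` cancel in the determinant.
    have h2 : (Matrix.of fun a i => U (Sum.inr a) (h.stepsEquiv (Sum.inr i))).transpose =
        Matrix.of fun i a : Fin c => ((-1 : R) ^ (col i) * (-1) ^ (i : ℕ)) *
          (Matrix.of fun i a : Fin c => (-1 : R) ^ (a : ℕ) *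
            (Matrix.of fun i j : Fin c => esymmInt y ((col i : ℤ) - i + j)) i a) i a := by
      ext i a
      have := h.le_right i
      simp only [Matrix.transpose_apply, Matrix.of_apply, U, Sum.elim_inr, hP]
      rw [coeff_X_pow_mul_prod_X_sub_C]
      simp only [stepsEquiv, steps, Equiv.ofBijective_apply, Sum.elim_inr]
      have e1 : (n : ℤ) + a - ((n + i - col i : ℕ) : ℤ) = (col i : ℤ) - i + a := by omega
      rw [e1, ← mul_assoc, ← pow_add, ← pow_add]
      congr 1
      have : n + a + (n + i - col i) + 2 * col i = col i + i + a + 2 * n := by omega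
      have := congrArg (fun e => (-1 : R) ^ e) this
      simpa [pow_add, pow_mul] using this
    rw [h2, Matrix.det_mul_column, Matrix.det_mul_row, Finset.prod_mul_distrib]
    have h3 : (∏ i : Fin c, (-1 : R) ^ (i : ℕ)) * ∏ i : Fin c, (-1 : R) ^ (i : ℕ) = 1 := by
      rw [← Finset.prod_mul_distrib]
      exact Finset.prod_eq_one fun i _ => by rw [← mul_pow]; simp
    linear_combination (∏ i, (-1) ^ col i) *
      (Matrix.of fun i j : Fin c => esymmInt y ((col i : ℤ) - i + j)).det * h3
  have hV : (V.submatrix h.stepsEquiv id).det =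
      (∏ i, (-1) ^ col i) * (Matrix.of fun i j : Fin n => y i ^ (j : ℕ)).det := by
    have e1 : V.submatrix h.stepsEquiv id = ((V.submatrix id finSumFinEquiv.symm).submatrix
        (finSumFinEquiv.symm.trans h.stepsEquiv) id).submatrix finSumFinEquiv finSumFinEquiv := by
      ext; simp
    have e2 : V.submatrix id finSumFinEquiv.symm = (Matrix.fromBlocks
        (Matrix.of fun i j : Fin n => y i ^ (j : ℕ)).transpose 0
        (Matrix.of fun (b : Fin c) (i : Fin n) => y i ^ (n + b)) 1).submatrix
          finSumFinEquiv.symm finSumFinEquiv.symm := by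
      ext q s
      obtain ⟨q, rfl⟩ := finSumFinEquiv.surjective q
      obtain ⟨s, rfl⟩ := finSumFinEquiv.surjective s
      rcases q with q | q <;> rcases s with s | s
      · simp [V]
      · simp [V]; omega
      · simp [V]
      · simp [V, Matrix.one_apply, Fin.ext_iff]
    rw [e1, Matrix.det_submatrix_equiv_self, Matrix.det_permute, e2,
      Matrix.det_submatrix_equiv_self, Matrix.det_fromBlocks_zero₁₂, Matrix.det_one, mul_one,
      Matrix.det_transpose, h.sign_stepsEquiv]
    push_cast
    rfl
  rw [← hUV, hdet, hU, hV]
  have h3 : (∏ i : Fin c, (-1 : R) ^ (col i)) * ∏ i : Fin c, (-1 : R) ^ (col i) = 1 := by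
    rw [← Finset.prod_mul_distrib]
    exact Finset.prod_eq_one fun i _ => by rw [← mul_pow]; simp
  linear_combination -(Matrix.of fun i j : Fin n => y i ^ (j : ℕ)).det *
      (Matrix.of fun i j : Fin c => esymmInt y ((col i : ℤ) - i + j)).det * h3

end IsConjugate

end JacobiTrudi
end AffineFusion

namespace AffineFusion

/-! ### Jacobi–Trudi for Young diagrams -/

section Diagrams

variable {n : ℕ} {R : Type} [CommRing R]

theorem mem_diagramOfRows {f : ℕ → ℕ} (hf : Antitone f) (i j : ℕ) :
    (i, j) ∈ diagramOfRows n f hf ↔ i < n ∧ j < f i := by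
  rw [← YoungDiagram.mem_cells]
  simp [diagramOfRows]

theorem isConjugate_diagramOfRows {f : ℕ → ℕ} (hf : Antitone f) :
    IsConjugate (c := (diagramOfRows n f hf).rowLen 0) (fun j : Fin n => f (Fin.rev j))
      (fun i => (diagramOfRows n f hf).colLen i) where
  mono i j h := hf (by have h' : (i : ℕ) ≤ j := h; simp only [Fin.val_rev]; omega)
  anti i j h := YoungDiagram.colLen_anti _ _ _ h
  le_left j := by
    by_contra! h
    have h1 : ((Fin.rev j : ℕ), (diagramOfRows n f hf).rowLen 0) ∈ diagramOfRows n f hf :=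
      (mem_diagramOfRows hf _ _).2 ⟨(Fin.rev j).2, h⟩
    have h2 := YoungDiagram.up_left_mem _ (Nat.zero_le _) le_rfl h1
    rw [YoungDiagram.mem_iff_lt_rowLen] at h2
    omega
  le_right i := by
    by_contra! h
    have h1 := YoungDiagram.mem_iff_lt_colLen.2 h
    rw [mem_diagramOfRows] at h1
    omega
  iff i j := by
    have h1 := mem_diagramOfRows (n := n) hf (Fin.rev j) i
    rw [YoungDiagram.mem_iff_lt_colLen] at h1
    simp only [Fin.val_rev] at h1 ⊢
    omega

/-- The dual Jacobi–Trudi identity for the alternants `det (yᵢ ^ (fⱼ + n - 1 - j))`. -/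
theorem det_esymmInt_mul_alternant {f : ℕ → ℕ} (hf : Antitone f) (y : Fin n → R) :
    (Matrix.of fun i j : Fin ((diagramOfRows n f hf).rowLen 0) =>
      esymmInt y (((diagramOfRows n f hf).colLen i : ℤ) - (i : ℤ) + (j : ℤ))).det *
      (Matrix.of fun i j : Fin n => y i ^ (n - 1 - (j : ℕ))).det =
      (Matrix.of fun i j : Fin n => y i ^ (f j + (n - 1 - (j : ℕ)))).det := by
  have h := (isConjugate_diagramOfRows (n := n) hf).det_esymmInt_mul_det_pow y
  have hv (j : Fin n) : n - 1 - (j : ℕ) = (Fin.revPerm j : ℕ) := by simp; omega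
  have e1 : (Matrix.of fun i j : Fin n => y i ^ (n - 1 - (j : ℕ))) =
      (Matrix.of fun i j : Fin n => y i ^ (j : ℕ)).submatrix id Fin.revPerm := by
    ext i j
    simp only [hv, Matrix.submatrix_apply, Matrix.of_apply, id]
  have e2 : (Matrix.of fun i j : Fin n => y i ^ (f j + (n - 1 - (j : ℕ)))) =
      (Matrix.of fun i j : Fin n => y i ^ (f (Fin.rev j) + j)).submatrix id Fin.revPerm := by
    ext i j
    simp only [hv, Matrix.submatrix_apply, Matrix.of_apply, id, Fin.revPerm_apply, Fin.rev_rev]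
  rw [e1, e2, Matrix.det_permute', Matrix.det_permute', ← h]
  ring

end Diagrams

/-! ### Rows, level and degree of a weight -/

section WeightCoordinates

namespace Weight

variable {n k : ℕ}

/-- The strictly decreasing coordinates `λⱼ + n - 1 - j` of a weight. -/
def ell (m : Weight n k) (j : ℕ) : ℕ := m.row j + (n - 1 - j)

theorem row_pred (m : Weight n k) {j : ℕ} (hj : j + 1 < n) :
    m.row j = m.row (j + 1) + m.1 ⟨j + 1, hj⟩ := by
  have : m.1 ⟨j + 1, hj⟩ = ∑ i : Fin n, if i = ⟨j + 1, hj⟩ then m.1 i else 0 := by simp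
  rw [this, row, row, ← Finset.sum_add_distrib]
  refine Finset.sum_congr rfl fun i _ => ?_
  simp only [Fin.ext_iff]
  split_ifs <;> omega

theorem row_zero_add [NeZero n] (m : Weight n k) : m.row 0 + m.1 0 = k := by
  have : m.1 0 = ∑ i : Fin n, if i = 0 then m.1 i else 0 := by simp
  rw [this, row, ← Finset.sum_add_distrib]
  refine Eq.trans (Finset.sum_congr rfl fun i _ => ?_) m.2
  by_cases hi : i = 0
  · subst hi; simp
  · simp [hi, Nat.pos_of_ne_zero (fun h => hi (Fin.ext h))]

theorem row_eq_zero (m : Weight n k) {j : ℕ} (hj : n ≤ j + 1) : m.row j = 0 := by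
  refine Finset.sum_eq_zero fun i _ => ?_
  rw [if_neg (by omega)]

/-- The number of boxes of the partition of the affine weight. -/
def degree [NeZero n] (m : Weight n k) : ℕ := ∑ i : Fin n, (if i = 0 then n else (i : ℕ)) * m.1 i

/-- This identifies `degree` with the degree of homogeneity of the Schur polynomial of the affine
diagram; hence vertex 0 counts `n` boxes, not 0. -/
theorem sum_affineRow [NeZero n] (m : Weight n k) :
    ∑ i : Fin n, m.affineRow i = m.degree := by
  simp only [affineRow, Fin.is_lt, if_true, Finset.sum_add_distrib, row, Finset.sum_const,
    Finset.card_univ, Fintype.card_fin, smul_eq_mul]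
  rw [Finset.sum_comm]
  have h1 (j : Fin n) : ∑ i : Fin n, (if (i : ℕ) < j then m.1 j else 0) = j * m.1 j := by
    rw [← Finset.sum_filter, Finset.sum_const, smul_eq_mul]
    congr 1
    have : (Finset.univ.filter fun i : Fin n => (i : ℕ) < j) = Finset.Iio j := by
      ext i; simp
    rw [this, Fin.card_Iio]
  have h2 : n * m.1 0 = ∑ i : Fin n, if i = 0 then n * m.1 i else 0 := by simp
  rw [h2, degree, ← Finset.sum_add_distrib]
  refine Finset.sum_congr rfl fun i _ => ?_
  rw [h1]
  by_cases hi : i = 0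
  · subst hi; simp
  · simp [hi]

end Weight

end WeightCoordinates

/-! ### Alternants, their Pieri rule and their vanishing on walls -/

section Alternants

variable {n k : ℕ}

/-- The character `exp (-2πi x / (k + n))`. -/
noncomputable def phase (n k : ℕ) (x : ℝ) : ℂ :=
  Complex.exp (-(2 * Real.pi * Complex.I) / ((k : ℂ) + n) * (x : ℂ))

theorem phase_add (x y : ℝ) : phase n k (x + y) = phase n k x * phase n k y := by
  rw [phase, phase, phase, ← Complex.exp_add]; push_cast; ring_nf

@[simp] theorem phase_zero : phase n k 0 = 1 := by simp [phase]

theorem phase_ne_zero (x : ℝ) : phase n k x ≠ 0 := Complex.exp_ne_zero _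

theorem phase_sum {ι : Type} (s : Finset ι) (f : ι → ℝ) :
    phase n k (∑ i ∈ s, f i) = ∏ i ∈ s, phase n k (f i) := by
  classical
  induction s using Finset.induction_on with
  | empty => simp
  | insert a s ha ih => rw [Finset.sum_insert ha, Finset.prod_insert ha, phase_add, ih]

theorem phase_mul_natCast (x : ℝ) (a : ℕ) : phase n k (x * a) = phase n k x ^ a := by
  rw [phase, phase, ← Complex.exp_nat_mul]; push_cast; ring_nf

theorem phase_eq_one_iff [NeZero n] (x : ℝ) :
    phase n k x = 1 ↔ ∃ a : ℤ, x = a * ((k : ℝ) + n) := by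
  have hN : (k : ℂ) + n ≠ 0 := by
    have := NeZero.pos n
    exact_mod_cast (by omega : k + n ≠ 0)
  have hN' : (k : ℝ) + n ≠ 0 := by exact_mod_cast hN
  rw [phase, Complex.exp_eq_one_iff]
  have hpi : (2 * Real.pi * Complex.I : ℂ) ≠ 0 := Complex.two_pi_I_ne_zero
  constructor
  · rintro ⟨a, ha⟩
    refine ⟨-a, ?_⟩
    have h1 : (x : ℂ) = -a * ((k : ℂ) + n) := by
      field_simp at ha
      have := mul_left_cancel₀ hpi (a := 2 * Real.pi * Complex.I) (b := -(x : ℂ))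
        (c := a * ((k : ℂ) + n)) (by linear_combination (2 * Real.pi * Complex.I) * ha)
      linear_combination -this
    have h2 : ((x : ℝ) : ℂ) = ((((-a : ℤ) : ℝ) * ((k : ℝ) + n) : ℝ) : ℂ) := by
      rw [h1]; push_cast; ring
    exact_mod_cast h2
  · rintro ⟨a, rfl⟩
    refine ⟨-a, ?_⟩
    push_cast
    field_simp

/-- The average of the coordinates `λⱼ + n - 1 - j`. -/
noncomputable def ellMean (m : Weight n k) : ℝ := (∑ i : Fin n, (m.ell i : ℝ)) / n

/-- The vector ρ differs from `(n - 1 - j)` by a constant, so λ + ρ is the integer vector `ell`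
recentred to have sum zero. -/
theorem shifted_eq [NeZero n] (m : Weight n k) (j : Fin n) :
    shifted m j = m.ell j - ellMean m := by
  have hn : (n : ℝ) ≠ 0 := NeZero.ne _
  have h1 (j : Fin n) : ((n - 1 - (j : ℕ) : ℕ) : ℝ) = n - 1 - j := by
    have := j.2
    rw [Nat.cast_sub (by omega), Nat.cast_sub (by omega)]; simp
  have h2 : ∑ j : Fin n, ((j : ℕ) : ℝ) = n * (n - 1) / 2 := by
    have := Finset.sum_range_id_mul_two n
    rw [Finset.sum_range] at this
    have h3 := congrArg (fun x : ℕ => (x : ℝ)) this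
    have hn1 : 1 ≤ n := NeZero.pos n
    push_cast [Nat.cast_sub hn1] at h3
    linarith
  simp only [shifted, ellMean, Weight.ell, Nat.cast_add, h1, Finset.sum_add_distrib,
    Finset.sum_sub_distrib, h2, Finset.sum_const, Finset.card_univ, Fintype.card_fin, nsmul_eq_mul]
  field_simp
  ring

theorem sum_shifted [NeZero n] (m : Weight n k) : ∑ j, shifted m j = 0 := by
  have hn : (n : ℝ) ≠ 0 := NeZero.ne _
  simp only [shifted_eq, Finset.sum_sub_distrib, ellMean, Finset.sum_const, Finset.card_univ,
    Fintype.card_fin, nsmul_eq_mul]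
  field_simp
  ring

/-- The antisymmetrised exponential `∑_w (-1)^ℓ(w) exp (-2πi (σ + ρ, w v) / (k + n))`. -/
noncomputable def alt (s : Weight n k) (v : Fin n → ℝ) : ℂ :=
  (Matrix.of fun i j => phase n k (shifted s i * v j)).det

/-- The points at which the characters are evaluated. -/
noncomputable def point (s : Weight n k) (i : Fin n) : ℂ := phase n k (shifted s i)

theorem alt_eq_sum (s : Weight n k) (v : Fin n → ℝ) : alt s v =
    ∑ w : Equiv.Perm (Fin n), ((Equiv.Perm.sign w : ℤˣ) : ℤ) *
      phase n k (∑ j, shifted s (w j) * v j) := by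
  simp only [alt, Matrix.det_apply', phase_sum, Matrix.of_apply]

/-- Constant vectors are orthogonal to σ + ρ, whose coordinates sum to zero. Alternants can
therefore be computed on the integer coordinates `ell`. -/
theorem alt_add_const [NeZero n] (s : Weight n k) (v : Fin n → ℝ) (c : ℝ) :
    alt s (fun j => v j + c) = alt s v := by
  rw [alt_eq_sum, alt_eq_sum]
  refine Finset.sum_congr rfl fun w _ => ?_
  simp only [mul_add, Finset.sum_add_distrib, ← Finset.sum_mul]
  rw [Equiv.sum_comp w (shifted s), sum_shifted, zero_mul, add_zero]

theorem alt_natCast (s : Weight n k) (e : Fin n → ℕ) :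
    alt s (fun j => e j) = (Matrix.of fun i j => point s i ^ e j).det := by
  simp only [alt, phase_mul_natCast, point]

theorem alt_shifted [NeZero n] (s m : Weight n k) :
    alt s (shifted m) = (Matrix.of fun i (j : Fin n) => point s i ^ m.ell j).det := by
  rw [← alt_natCast, ← alt_add_const s (fun j => ((m.ell j : ℕ) : ℝ)) (- ellMean m)]
  congr 1; ext j; rw [shifted_eq]; ring

/-- This matches the convention `eₙ = z`: the top elementary symmetric polynomial of the `t * point
s i` is `t ^ n`. -/
theorem prod_point [NeZero n] (s : Weight n k) : ∏ i, point s i = 1 := by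
  simp only [point]
  rw [← phase_sum, sum_shifted, phase_zero]

/-- The Pieri rule for alternants. -/
theorem sum_alt_add_indicator (s : Weight n k) (v : Fin n → ℝ) (r : ℕ) :
    ∑ I ∈ Finset.univ.powersetCard r, alt s (fun j => v j + if j ∈ I then 1 else 0) =
      esymmInt (point s) r * alt s v := by
  simp only [alt_eq_sum]
  rw [Finset.sum_comm, Finset.mul_sum]
  refine Finset.sum_congr rfl fun w _ => ?_
  have h1 (I : Finset (Fin n)) :
      phase n k (∑ j, shifted s (w j) * (v j + if j ∈ I then 1 else 0)) =
        phase n k (∑ j, shifted s (w j) * v j) * ∏ i ∈ I, point s (w i) := by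
    simp only [mul_add, Finset.sum_add_distrib, phase_add]
    congr 1
    simp only [mul_ite, mul_one, mul_zero, point, Finset.sum_ite_mem, Finset.univ_inter]
    exact phase_sum _ _
  simp only [h1]
  have h2 : ∑ I ∈ Finset.univ.powersetCard r, ∏ i ∈ I, point s (w i) = esymmInt (point s) r := by
    rw [esymmInt_natCast]
    refine Finset.sum_equiv (Equiv.finsetCongr w) (fun I => ?_) (fun I _ => ?_)
    · simp [Finset.mem_powersetCard]
    · simp [Equiv.finsetCongr_apply, Finset.prod_map]
  rw [← h2, Finset.sum_mul]
  exact Finset.sum_congr rfl fun I _ => by ring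

theorem alt_eq_zero (s : Weight n k) (v : Fin n → ℝ) {i j : Fin n} (hij : i ≠ j) (h : v i = v j) :
    alt s v = 0 :=
  Matrix.det_zero_of_column_eq hij fun a => by simp [h]

/-- Coordinates of σ + ρ differ by integers, and integer multiples of `k + n` have trivial phase. -/
theorem phase_shifted_mul_level [NeZero n] (s : Weight n k) (a b : Fin n) :
    phase n k (shifted s a * ((k : ℝ) + n)) = phase n k (shifted s b * ((k : ℝ) + n)) := by
  have : shifted s a * ((k : ℝ) + n) = shifted s b * ((k : ℝ) + n) +
      ((s.ell a : ℤ) - (s.ell b : ℤ) : ℤ) * ((k : ℝ) + n) := by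
    rw [shifted_eq, shifted_eq]; push_cast; ring
  rw [this, phase_add, (phase_eq_one_iff _).2 ⟨_, rfl⟩, mul_one]

/-- Vanishing on the affine wall: translating a coordinate by `k + n` only rescales its column, so
two columns are proportional. -/
theorem alt_eq_zero_of_level [NeZero n] (s : Weight n k) (v : Fin n → ℝ) {i j : Fin n}
    (hij : i ≠ j) (h : v i = v j + ((k : ℝ) + n)) : alt s v = 0 := by
  have h1 : (Matrix.of fun a b => phase n k (shifted s a * v b)) =
      (Matrix.of fun a b => phase n k (shifted s a * v b)).updateCol i
        (phase n k (shifted s i * ((k : ℝ) + n)) • fun a => phase n k (shifted s a * v j)) := by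
    ext a b
    by_cases hb : b = i
    · subst hb
      simp only [Matrix.of_apply, Matrix.updateCol_self, Pi.smul_apply, smul_eq_mul]
      rw [h, mul_add, phase_add, phase_shifted_mul_level s b a, mul_comm]
    · simp [hb]
  rw [alt, h1, Matrix.det_updateCol_smul,
    Matrix.det_zero_of_column_eq hij (fun a => by simp [hij.symm]), mul_zero]

end Alternants
end AffineFusion

namespace AffineFusion

/-! ### Calculus of left eigenvectors -/

section LeftEigen

variable {n k : ℕ}

/-- The functional with coefficients `ψ` is an eigenvector of the transpose of `T`. -/
def IsLeftEigen (ψ : Weight n k → ℂ) (T : Module.End ℂ (Weight n k → ℂ)) (c : ℂ) : Prop :=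
  ∀ v, ψ ⬝ᵥ T v = c * (ψ ⬝ᵥ v)

namespace IsLeftEigen

variable {ψ : Weight n k → ℂ}

theorem of_single {T : Module.End ℂ (Weight n k → ℂ)} {c : ℂ}
    (h : ∀ m, ψ ⬝ᵥ T (Pi.single m 1) = c * ψ m) : IsLeftEigen ψ T c := by
  intro v
  have hv : v = ∑ m, v m • Pi.single m (1 : ℂ) := by
    ext q; simp [Finset.sum_apply, Pi.single_apply]
  rw [hv]
  simp only [map_sum, map_smul, dotProduct_sum, dotProduct_smul, h, Finset.mul_sum,
    dotProduct_single, smul_eq_mul, mul_one]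
  exact Finset.sum_congr rfl fun m _ => by ring

theorem smul_one (ψ : Weight n k → ℂ) (z : ℂ) : IsLeftEigen ψ (z • 1) z := fun v => by
  simp [dotProduct_smul]

theorem zero (ψ : Weight n k → ℂ) : IsLeftEigen ψ 0 0 := fun v => by simp

theorem smul {T : Module.End ℂ (Weight n k → ℂ)} {c : ℂ} (h : IsLeftEigen ψ T c) (a : ℤ) :
    IsLeftEigen ψ (a • T) (a * c) := fun v => by
  rw [LinearMap.smul_apply, dotProduct_smul, h v, zsmul_eq_mul, mul_assoc]

theorem mul {S T : Module.End ℂ (Weight n k → ℂ)} {c d : ℂ} (hS : IsLeftEigen ψ S c)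
    (hT : IsLeftEigen ψ T d) : IsLeftEigen ψ (S * T) (c * d) := fun v => by
  rw [Module.End.mul_apply, hS, hT, mul_assoc]

theorem sum {ι : Type} (s : Finset ι) {T : ι → Module.End ℂ (Weight n k → ℂ)} {c : ι → ℂ}
    (h : ∀ i ∈ s, IsLeftEigen ψ (T i) (c i)) : IsLeftEigen ψ (∑ i ∈ s, T i) (∑ i ∈ s, c i) :=
  fun v => by
    rw [LinearMap.sum_apply, dotProduct_sum, Finset.sum_mul]
    exact Finset.sum_congr rfl fun i hi => h i hi v

theorem ofFn_prod {c : ℕ} {T : Fin c → Module.End ℂ (Weight n k → ℂ)} {a : Fin c → ℂ}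
    (h : ∀ i, IsLeftEigen ψ (T i) (a i)) : IsLeftEigen ψ (List.ofFn T).prod (∏ i, a i) := by
  induction c with
  | zero => simpa using smul_one ψ 1
  | succ c ih =>
    rw [List.ofFn_succ, List.prod_cons, Fin.prod_univ_succ]
    exact (h 0).mul (ih fun i => h i.succ)

end IsLeftEigen

end LeftEigen

/-! ### Alternants as common left eigenvectors of the noncommutative polynomials -/

section Eigenvectors

variable {n k : ℕ} [NeZero n]

omit [NeZero n] in
theorem sum_single_indicator (I : Finset (Fin n)) (j : Fin n) :
    (∑ i ∈ I, Pi.single i 1 : Fin n → ℕ) j = if j ∈ I then 1 else 0 := by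
  simp [Finset.sum_apply, Pi.single_apply]

theorem sum_single_succ_indicator (I : Finset (Fin n)) (j : Fin n) :
    (∑ i ∈ I, Pi.single (i + 1) 1 : Fin n → ℕ) j = if j - 1 ∈ I then 1 else 0 := by
  simp [Finset.sum_apply, Pi.single_apply, ← sub_eq_iff_eq_add]

/-- Lengthening a column from `i` to `i + 1` adds a box in row `i`. The term for `i + 1 = 0`
corrects for a full column of length `n` being read as empty. -/
theorem fin_lt_add_one_indicator (i j : Fin n) :
    (if j < i + 1 then 1 else 0) + (if i + 1 = 0 then 1 else 0) =
      (if j < i then 1 else 0) + (if j = i then 1 else 0 : ℕ) := by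
  obtain ⟨n', rfl⟩ : ∃ n', n = n' + 1 := ⟨n - 1, by have := NeZero.pos n; omega⟩
  by_cases hi : i = Fin.last n'
  · subst hi
    simp only [Fin.last_add_one, Fin.not_lt_zero, if_false, if_true]
    rcases (Fin.le_last j).lt_or_eq with h | h
    · simp [h, h.ne]
    · simp [h]
  · have h1 : (i + 1 : Fin (n' + 1)).val = i.val + 1 := by rw [Fin.val_add_one, if_neg hi]
    have h2 : i + 1 ≠ 0 := fun h => by rw [Fin.ext_iff, h1] at h; simp at h
    rw [if_neg h2]
    simp only [Fin.lt_def, Fin.ext_iff, h1]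
    split_ifs <;> omega

/-- Each `aᵢ` adds a box in row `i`. The constant collects the change of mean and the full column
deleted when `n - 1 ∈ I`. -/
theorem shifted_of_add_eq {I : Finset (Fin n)} {m p : Weight n k}
    (h : p.1 + ∑ i ∈ I, Pi.single i 1 = m.1 + ∑ i ∈ I, Pi.single (i + 1) 1) :
    ∃ c : ℝ, ∀ j, shifted p j = (shifted m j + if j ∈ I then 1 else 0) + c := by
  have h' (i : Fin n) : p.1 i + (if i ∈ I then 1 else 0) = m.1 i + if i - 1 ∈ I then 1 else 0 := by
    have := congrFun h i
    rwa [Pi.add_apply, Pi.add_apply, sum_single_indicator, sum_single_succ_indicator] at this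
  have key (j : Fin n) : p.row j + (∑ i ∈ I, if i + 1 = 0 then 1 else 0) =
      m.row j + if j ∈ I then 1 else 0 := by
    have e1 : p.row j + (∑ i ∈ I, if j < i then 1 else 0) =
        m.row j + ∑ i ∈ I, if j < i + 1 then 1 else 0 := by
      have e2 : ∑ i ∈ I, (if j < i then 1 else 0) =
          ∑ i : Fin n, if (j : ℕ) < i then (if i ∈ I then 1 else 0) else 0 := by
        rw [← Finset.univ_inter I, ← Finset.sum_ite_mem]
        refine Finset.sum_congr rfl fun i _ => ?_
        simp only [Fin.lt_def, Finset.univ_inter]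
        split_ifs <;> rfl
      have e3 : ∑ i ∈ I, (if j < i + 1 then 1 else 0) =
          ∑ i : Fin n, if (j : ℕ) < i then (if i - 1 ∈ I then 1 else 0) else 0 := by
        rw [← Finset.univ_inter I, ← Finset.sum_ite_mem, ← Equiv.sum_comp (Equiv.addRight 1)
          (fun i : Fin n => if (j : ℕ) < i then (if i - 1 ∈ Finset.univ ∩ I then 1 else 0) else 0)]
        refine Finset.sum_congr rfl fun i _ => ?_
        simp only [Fin.lt_def, Finset.univ_inter, Equiv.coe_addRight, add_sub_cancel_right]
        split_ifs <;> rfl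
      rw [e2, e3, Weight.row, Weight.row, ← Finset.sum_add_distrib, ← Finset.sum_add_distrib]
      refine Finset.sum_congr rfl fun i _ => ?_
      have := h' i
      by_cases hj : (j : ℕ) < i
      · simp only [hj, if_true]; exact this
      · simp only [hj, if_false]
    have e4 : ∑ i ∈ I, (if j < i + 1 then 1 else 0) + ∑ i ∈ I, (if i + 1 = 0 then 1 else 0) =
        ∑ i ∈ I, (if j < i then 1 else 0) + if j ∈ I then 1 else 0 := by
      rw [← Finset.sum_add_distrib]
      simp only [fin_lt_add_one_indicator]
      rw [Finset.sum_add_distrib, Finset.sum_ite_eq]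
    omega
  refine ⟨ellMean m - ellMean p - ((∑ i ∈ I, if i + 1 = 0 then 1 else 0 : ℕ) : ℝ), fun j => ?_⟩
  have h1 := congrArg (fun x : ℕ => (x : ℝ)) (key j)
  simp only [Nat.cast_add] at h1
  rw [shifted_eq, shifted_eq, Weight.ell, Weight.ell, Nat.cast_add, Nat.cast_add]
  have h2 : (((if j ∈ I then 1 else 0 : ℕ) : ℕ) : ℝ) = if j ∈ I then 1 else 0 := by split_ifs <;> simp
  rw [h2] at h1
  linear_combination h1

/-- Each `aᵢ` adds one box, except that `a₀` turns a column of length `n` into one of length 1; the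
factor `z = t ^ n` compensates exactly for this loss. -/
theorem degree_of_add_eq {I : Finset (Fin n)} {m p : Weight n k}
    (h : p.1 + ∑ i ∈ I, Pi.single i 1 = m.1 + ∑ i ∈ I, Pi.single (i + 1) 1) :
    p.degree + (if 0 ∈ I then n else 0) = m.degree + I.card := by
  let D : (Fin n → ℕ) →+ ℕ :=
    { toFun := fun f => ∑ i : Fin n, (if i = 0 then n else (i : ℕ)) * f i
      map_zero' := by simp
      map_add' := fun f g => by simp [mul_add, Finset.sum_add_distrib] }
  have hD (i : Fin n) : D (Pi.single i 1) = if i = 0 then n else (i : ℕ) := by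
    simp only [D, AddMonoidHom.coe_mk, ZeroHom.coe_mk, Pi.single_apply, mul_ite, mul_one, mul_zero,
      Finset.sum_ite_eq', Finset.mem_univ, if_true]
  have h1 := congrArg D h
  rw [map_add, map_add, map_sum, map_sum] at h1
  simp only [hD] at h1
  have h2 (i : Fin n) : (if i + 1 = 0 then n else ((i + 1 : Fin n) : ℕ)) + (if i = 0 then n else 0) =
      (if i = 0 then n else (i : ℕ)) + 1 := by
    obtain ⟨n', rfl⟩ : ∃ n', n = n' + 1 := ⟨n - 1, by have := NeZero.pos n; omega⟩
    by_cases hi : i = Fin.last n'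
    · subst hi
      simp only [Fin.last_add_one, if_true, Fin.val_last]
      by_cases h0 : Fin.last n' = 0
      · have : n' = 0 := congrArg Fin.val h0
        rw [if_pos h0, if_pos h0]; omega
      · rw [if_neg h0, if_neg h0, add_zero]
    · have h1 : (i + 1 : Fin (n' + 1)).val = i.val + 1 := by rw [Fin.val_add_one, if_neg hi]
      have h3 : i + 1 ≠ 0 := fun h => by rw [Fin.ext_iff, h1] at h; simp at h
      rw [if_neg h3, h1]
      by_cases h0 : i = 0
      · have h00 : (i : ℕ) = 0 := by rw [h0]; rfl
        rw [h00, if_pos h0]; omega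
      · simp [h0]
  have h3 := Finset.sum_congr (rfl : I = I) fun i _ => h2 i
  rw [Finset.sum_add_distrib, Finset.sum_add_distrib, Finset.sum_ite_eq', ← Finset.card_eq_sum_ones]
    at h3
  have h4 : D p.1 = p.degree := rfl
  have h5 : D m.1 = m.degree := rfl
  omega

/-- The coefficients of a simultaneous left eigenvector of the `e_r(𝒜)` at `z = t ^ n`. -/
noncomputable def eigenCoeff (s : Weight n k) (t : ℂ) (p : Weight n k) : ℂ :=
  t ^ p.degree * alt s (shifted p)

/-- If the move is forbidden, some `j ∈ I` has `j - 1 ∉ I` and label 0. For `j ≠ 0` the coordinates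
`j - 1` and `j` differ by 1 and become equal. For `j = 0` the first and last coordinates differ by
`k + n - 1` and the move puts them on the affine wall. -/
theorem exists_add_eq_or_alt_eq_zero (hn : 2 ≤ n) (s m : Weight n k) (I : Finset (Fin n)) :
    (∃ p : Weight n k, p.1 + ∑ i ∈ I, Pi.single i 1 = m.1 + ∑ i ∈ I, Pi.single (i + 1) 1) ∨
      alt s (fun j => shifted m j + if j ∈ I then 1 else 0) = 0 := by
  by_cases hd : ∀ j, (if j ∈ I then 1 else 0) ≤ m.1 j + if j - 1 ∈ I then 1 else 0
  · left
    have hadd : (fun j => m.1 j + (if j - 1 ∈ I then 1 else 0) - if j ∈ I then 1 else 0) +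
        ∑ i ∈ I, Pi.single i 1 = m.1 + ∑ i ∈ I, Pi.single (i + 1) 1 := by
      ext j
      simp only [Pi.add_apply, sum_single_indicator, sum_single_succ_indicator]
      have := hd j
      omega
    refine ⟨⟨_, ?_⟩, hadd⟩
    have h1 := congrArg (fun f => ∑ j, f j) hadd
    have h2 (c : Fin n → Fin n) : ∑ j, (∑ i ∈ I, Pi.single (c i) 1 : Fin n → ℕ) j = I.card := by
      simp only [Finset.sum_apply]
      rw [Finset.sum_comm]
      simp
    simp only [Pi.add_apply, Finset.sum_add_distrib, h2 (fun i => i), h2 (fun i => i + 1), m.2] at h1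
    have h3 : ∑ j, (m.1 j + (if j - 1 ∈ I then 1 else 0) - if j ∈ I then 1 else 0) + I.card =
        k + I.card := h1
    exact Nat.add_right_cancel h3
  · right
    push Not at hd
    obtain ⟨j, hj⟩ := hd
    have hjI : j ∈ I := by by_contra h; simp [h] at hj
    have hjI' : j - 1 ∉ I := by intro h; simp [h, hjI] at hj
    have hmj : m.1 j = 0 := by simpa [hjI, hjI'] using hj
    have hne : j - 1 ≠ j := fun h => hjI' (h.symm ▸ hjI)
    obtain ⟨n', rfl⟩ : ∃ n', n = n' + 1 := ⟨n - 1, by omega⟩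
    by_cases h0 : j = 0
    · subst h0
      have hlast : (0 : Fin (n' + 1)) - 1 = Fin.last n' := by
        rw [sub_eq_iff_eq_add, Fin.last_add_one]
      rw [hlast] at hne hjI'
      refine alt_eq_zero_of_level s _ hne.symm ?_
      have h1 := m.row_zero_add
      have h2 := m.row_eq_zero (j := n') le_rfl
      simp only [shifted_eq, Weight.ell, hjI, hjI', if_true, if_false, Fin.val_last, h2, Fin.val_zero]
      have h3 : m.row 0 = k := by omega
      rw [h3]; push_cast; simp; ring
    · have hj1 : (j - 1 : Fin (n' + 1)).val + 1 = j.val := by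
        have hl : j - 1 ≠ Fin.last n' := fun h => h0 (by
          have := congrArg (· + 1) h
          simpa using this)
        have := Fin.val_add_one (j - 1)
        rw [if_neg hl, sub_add_cancel] at this
        exact this.symm
      refine alt_eq_zero s _ hne ?_
      have h1 := m.row_pred (j := (j - 1 : Fin (n' + 1)).val) (by omega)
      have h2 : (⟨(j - 1 : Fin (n' + 1)).val + 1, by omega⟩ : Fin (n' + 1)) = j := Fin.ext hj1
      rw [h2, hmj, add_zero, hj1] at h1
      simp only [shifted_eq, hjI, hjI', if_true, if_false]
      have h3 : m.ell (j - 1 : Fin (n' + 1)) = m.ell j + 1 := by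
        simp only [Weight.ell, h1]; omega
      rw [h3]; push_cast; ring

theorem eigenCoeff_dotProduct_cyclicProd (hn : 2 ≤ n) (s m : Weight n k) (t : ℂ)
    {I : Finset (Fin n)} (hI : I ≠ Finset.univ) :
    eigenCoeff s t ⬝ᵥ cyclicProd n k (t ^ n) I (Pi.single m 1) =
      t ^ (m.degree + I.card) * alt s (fun j => shifted m j + if j ∈ I then 1 else 0) := by
  simp only [dotProduct, cyclicProd_apply_single (t ^ n) hn hI]
  have hval (p : Weight n k)
      (h : p.1 + ∑ i ∈ I, Pi.single i 1 = m.1 + ∑ i ∈ I, Pi.single (i + 1) 1) :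
      eigenCoeff s t p * (if 0 ∈ I then t ^ n else 1) =
        t ^ (m.degree + I.card) * alt s (fun j => shifted m j + if j ∈ I then 1 else 0) := by
    obtain ⟨c, hc⟩ := shifted_of_add_eq h
    rw [eigenCoeff, funext hc, alt_add_const, ← degree_of_add_eq h, pow_add]
    split_ifs <;> ring
  by_cases hp : ∃ p : Weight n k, p.1 + ∑ i ∈ I, Pi.single i 1 = m.1 + ∑ i ∈ I, Pi.single (i + 1) 1
  · obtain ⟨p, hp⟩ := hp
    rw [Finset.sum_eq_single p]
    · rw [if_pos hp, hval p hp]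
    · intro q _ hq
      rw [if_neg, mul_zero]
      intro h
      exact hq (Subtype.ext (add_right_cancel (h.trans hp.symm)))
    · exact fun h => absurd (Finset.mem_univ _) h
  · rw [(exists_add_eq_or_alt_eq_zero hn s m I).resolve_left hp, mul_zero]
    refine Finset.sum_eq_zero fun q _ => ?_
    rw [if_neg fun h => hp ⟨q, h⟩, mul_zero]

omit [NeZero n] in
theorem esymmInt_smul {R : Type} [CommRing R] (t : R) (y : Fin n → R) (r : ℕ) :
    esymmInt (fun i => t * y i) r = t ^ r * esymmInt y r := by
  rw [esymmInt_natCast, esymmInt_natCast, Finset.mul_sum]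
  refine Finset.sum_congr rfl fun I hI => ?_
  rw [Finset.prod_mul_distrib, Finset.prod_const, (Finset.mem_powersetCard.1 hI).2]

theorem isLeftEigen_elem (hn : 2 ≤ n) (s : Weight n k) (t : ℂ) (r : ℤ) :
    IsLeftEigen (eigenCoeff s t) (elem n k (t ^ n) r)
      (esymmInt (fun i => t * point s i) r) := by
  cases r with
  | negSucc r => exact IsLeftEigen.zero _
  | ofNat r =>
    simp only [elem]
    rw [Int.ofNat_eq_natCast, esymmInt_smul]
    split_ifs with hr
    · subst hr
      have : esymmInt (point s) r = 1 := by
        have h : (Finset.univ : Finset (Fin r)).powersetCard r = {Finset.univ} := by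
          simpa using Finset.powersetCard_self (Finset.univ : Finset (Fin r))
        rw [esymmInt_natCast, h, Finset.sum_singleton, prod_point]
      rw [this, mul_one]
      exact IsLeftEigen.smul_one _ _
    · refine IsLeftEigen.of_single fun m => ?_
      rw [LinearMap.sum_apply, dotProduct_sum]
      have (I) (hI : I ∈ (Finset.univ : Finset (Fin n)).powersetCard r) :
          eigenCoeff s t ⬝ᵥ cyclicProd n k (t ^ n) I (Pi.single m 1) = t ^ (m.degree + r) *
            alt s (fun j => shifted m j + if j ∈ I then 1 else 0) := by
        have hc := (Finset.mem_powersetCard.1 hI).2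
        rw [eigenCoeff_dotProduct_cyclicProd hn, hc]
        rintro rfl
        simp at hc
        omega
      rw [Finset.sum_congr rfl this, ← Finset.mul_sum, sum_alt_add_indicator, eigenCoeff, pow_add]
      ring

/-- The Leibniz expansion is evaluated on a common eigenvector, so commutativity of the entries is
not needed here. -/
theorem isLeftEigen_schur (hn : 2 ≤ n) (s : Weight n k) (t : ℂ) (Y : YoungDiagram) :
    IsLeftEigen (eigenCoeff s t) (schur n k (t ^ n) Y)
      (Matrix.of fun i j : Fin (Y.rowLen 0) =>
        esymmInt (fun i => t * point s i) ((Y.colLen i : ℤ) - (i : ℤ) + (j : ℤ))).det := by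
  -- `schur` uses the entries `(i, s i)`, whereas `Matrix.det_apply'` uses `(s i, i)`.
  rw [← Matrix.det_transpose, Matrix.det_apply']
  refine IsLeftEigen.sum _ fun w _ => ?_
  exact (IsLeftEigen.ofFn_prod fun i => isLeftEigen_elem hn s t _).smul _

end Eigenvectors
end AffineFusion

namespace AffineFusion

/-! ### Weights as strictly decreasing integer sequences -/

section EllCoordinates

namespace Weight

variable {n k : ℕ}

theorem ell_strictAnti (m : Weight n k) : StrictAnti fun j : Fin n => m.ell j := by
  intro a b hab
  have h1 : (a : ℕ) < b := hab
  have := m.row_antitone h1.le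
  simp only [ell]
  omega

variable [NeZero n]

theorem ell_lt (m : Weight n k) (j : Fin n) : m.ell j < k + n := by
  have h1 := m.row_zero_add
  have h2 := m.row_antitone (Nat.zero_le j)
  have := NeZero.pos n
  simp only [ell]
  omega

omit [NeZero n] in
theorem ell_last (m : Weight n k) : m.ell (n - 1) = 0 := by
  rw [ell, m.row_eq_zero (by omega)]; omega

theorem ell_injective : Function.Injective fun (m : Weight n k) (j : Fin n) => m.ell j := by
  intro m p h
  have hrow (j : ℕ) (hj : j < n) : m.row j = p.row j := by
    have := congrFun h ⟨j, hj⟩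
    simpa [ell] using this
  refine Subtype.ext (funext fun j => ?_)
  by_cases hj : j = 0
  · subst hj
    have h1 := m.row_zero_add
    have h2 := p.row_zero_add
    have := hrow 0 (NeZero.pos n)
    omega
  · obtain ⟨i, hi⟩ : ∃ i, (j : ℕ) = i + 1 :=
      ⟨j - 1, by have : (j : ℕ) ≠ 0 := fun h => hj (Fin.ext h); omega⟩
    have hin : i + 1 < n := hi ▸ j.2
    have h1 := m.row_pred hin
    have h2 := p.row_pred hin
    have h3 := hrow i (by omega)
    have h4 := hrow (i + 1) hin
    have h5 : (⟨i + 1, hin⟩ : Fin n) = j := Fin.ext hi.symm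
    rw [h5] at h1 h2
    omega

theorem exists_ell_eq {e : Fin n → ℕ} (he : StrictAnti e) (hlt : ∀ j, e j < k + n)
    (hzero : ∃ j, e j = 0) : ∃ m : Weight n k, ∀ j : Fin n, m.ell j = e j := by
  obtain ⟨n', rfl⟩ : ∃ n', n = n' + 1 := ⟨n - 1, by have := NeZero.pos n; omega⟩
  have hlast : e (Fin.last n') = 0 := by
    obtain ⟨j, hj⟩ := hzero
    have := he.antitone (Fin.le_last j)
    omega
  -- The Dynkin labels are the gaps of the sequence minus 1, and label 0 is the room left below `k +
  -- n`. The weight is first formed at the tautological level `∑ j, c j`, since the proof that this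
  -- is `k` uses its coordinates.
  let c : Fin (n' + 1) → ℕ := Fin.cons (k + (n' + 1) - 1 - e 0)
    fun j : Fin n' => e j.castSucc - e j.succ - 1
  let w : Weight (n' + 1) (∑ j, c j) := ⟨c, rfl⟩
  have hell (d : ℕ) : ∀ j : ℕ, (hj : j < n' + 1) → j + d = n' → w.ell j = e ⟨j, hj⟩ := by
    induction d with
    | zero =>
      intro j hj hjd
      have : (⟨j, hj⟩ : Fin (n' + 1)) = Fin.last n' := Fin.ext (by simpa using hjd)
      rw [this, hlast, ell, w.row_eq_zero (by omega)]
      omega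
    | succ d ih =>
      intro j hj hjd
      have h1 := ih (j + 1) (by omega) (by omega)
      have h2 := w.row_pred (j := j) (by omega)
      have h3 : w.1 ⟨j + 1, by omega⟩ = e ⟨j, hj⟩ - e ⟨j + 1, by omega⟩ - 1 := by
        have := Fin.cons_succ (α := fun _ => ℕ) (k + (n' + 1) - 1 - e 0)
          (fun j : Fin n' => e j.castSucc - e j.succ - 1) ⟨j, by omega⟩
        exact this
      have h4 : e ⟨j + 1, by omega⟩ < e ⟨j, hj⟩ := he (Fin.mk_lt_mk.2 (by omega))
      rw [h3] at h2
      simp only [ell] at h1 ⊢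
      omega
  have hk : ∑ j, c j = k := by
    rw [← w.row_zero_add]
    have h1 := hell n' 0 (by omega) (by omega)
    have h2 : w.1 0 = k + (n' + 1) - 1 - e 0 := rfl
    have h3 := hlt 0
    have h4 : (⟨0, by omega⟩ : Fin (n' + 1)) = 0 := rfl
    rw [h4] at h1
    rw [h2]
    simp only [ell] at h1
    omega
  exact ⟨⟨c, hk⟩, fun j => hell (n' - j) j j.2 (by omega)⟩

/-- The diagram automorphism rotating the Dynkin labels. -/
def rotate : Weight n k ≃ Weight n k where
  toFun m := ⟨fun i => m.1 (i - 1), (Equiv.sum_comp (Equiv.subRight (1 : Fin n)) m.1).trans m.2⟩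
  invFun m := ⟨fun i => m.1 (i + 1), (Equiv.sum_comp (Equiv.addRight (1 : Fin n)) m.1).trans m.2⟩
  left_inv m := Subtype.ext (funext fun i => by simp)
  right_inv m := Subtype.ext (funext fun i => by simp)

/-- Up to a common shift, rotating the diagram moves the last coordinate to the front and raises it
by `k + n`. -/
theorem ell_rotate (m : Weight n k) :
    ∃ c : ℕ, ∀ j : Fin n, (rotate m).ell j + c = m.ell (j - 1 : Fin n) + if j = 0 then k + n else 0 := by
  obtain ⟨n', rfl⟩ : ∃ n', n = n' + 1 := ⟨n - 1, by have := NeZero.pos n; omega⟩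
  have hval (i : Fin (n' + 1)) (hi : i ≠ 0) : (i - 1 : Fin (n' + 1)).val + 1 = i.val := by
    have hl : i - 1 ≠ Fin.last n' := fun h => hi (by
      have := congrArg (· + 1) h
      simpa using this)
    have := Fin.val_add_one (i - 1)
    rw [if_neg hl, sub_add_cancel] at this
    exact this.symm
  have hlast : (0 : Fin (n' + 1)) - 1 = Fin.last n' := by
    rw [sub_eq_iff_eq_add, Fin.last_add_one]
  have hz : (rotate m).1 0 = m.1 (Fin.last n') := by
    change m.1 (0 - 1) = _
    rw [hlast]
  have h0 : (rotate m).row 0 + m.1 (Fin.last n') = k := by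
    rw [← hz]; exact (rotate m).row_zero_add
  refine ⟨1 + m.1 (Fin.last n'), fun j => ?_⟩
  by_cases hj : j = 0
  · subst hj
    rw [hlast, if_pos rfl, Fin.val_last]
    have := m.row_eq_zero (j := n') le_rfl
    simp only [ell, this, Fin.val_zero]
    omega
  · rw [if_neg hj]
    have h1 (i : ℕ) (hi : i + 1 < n' + 1) : (rotate m).row (i + 1) + m.1 (Fin.last n') = m.row i := by
      induction i with
      | zero =>
        have h2 := (rotate m).row_pred hi
        have h3 := m.row_zero_add
        have h4 : (rotate m).1 ⟨0 + 1, hi⟩ = m.1 0 := by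
          change m.1 (⟨0 + 1, hi⟩ - 1) = _
          have h5 := hval ⟨0 + 1, hi⟩ (fun h => by simp [Fin.ext_iff] at h)
          exact congrArg m.1 (Fin.ext (Nat.succ_injective h5))
        omega
      | succ i ih =>
        have h2 := (rotate m).row_pred hi
        have h3 := m.row_pred (j := i) (by omega)
        have h4 : (rotate m).1 ⟨i + 1 + 1, hi⟩ = m.1 ⟨i + 1, by omega⟩ := by
          change m.1 (⟨i + 1 + 1, hi⟩ - 1) = _
          have h5 := hval ⟨i + 1 + 1, hi⟩ (fun h => by simp [Fin.ext_iff] at h)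
          exact congrArg m.1 (Fin.ext (Nat.succ_injective h5))
        have h5 := ih (by omega)
        omega
    have h2 := hval j hj
    have h3 := h1 (j - 1 : Fin (n' + 1)) (by omega)
    simp only [ell]
    rw [h2] at h3
    omega

/-- The dual partition is the complement of λ in the rectangle with `n` rows of length `m.row 0`,
turned by 180 degrees. -/
theorem ell_flip (m : Weight n k) (j : Fin n) :
    m.flip.ell j + m.ell (Fin.rev j) = m.row 0 + (n - 1) := by
  have h1 : m.flip.row j + m.row (Fin.rev j) = m.row 0 := by
    have h2 : m.flip.row j = ∑ i : Fin n, if 0 < (i : ℕ) ∧ (i : ℕ) ≤ Fin.rev j then m.1 i else 0 := by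
      rw [row, ← Equiv.sum_comp (Equiv.neg (Fin n))]
      refine Finset.sum_congr rfl fun i _ => ?_
      have h3 : m.flip.1 (-i) = m.1 i := by change m.1 (- -i) = _; rw [neg_neg]
      simp only [Equiv.neg_apply, h3, Fin.val_rev]
      by_cases hi : i = 0
      · subst hi; simp
      · have h4 : ((-i : Fin n) : ℕ) = n - i := by
          rw [Fin.val_neg', Nat.mod_eq_of_lt]
          have : (i : ℕ) ≠ 0 := fun h => hi (Fin.ext h)
          omega
        have : (i : ℕ) ≠ 0 := fun h => hi (Fin.ext h)
        rw [h4]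
        refine if_congr ?_ rfl rfl
        omega
    rw [h2, row, row, ← Finset.sum_add_distrib]
    refine Finset.sum_congr rfl fun i _ => ?_
    split_ifs <;> omega
  simp only [ell]
  have := j.2
  simp only [Fin.val_rev] at h1 ⊢
  omega

end Weight

end EllCoordinates

/-! ### Orthogonality of alternants over the weights of level k -/

section Orthogonality

variable {n k : ℕ}

theorem alt_comp_perm (s : Weight n k) (v : Fin n → ℝ) (w : Equiv.Perm (Fin n)) :
    alt s (fun j => v (w j)) = ((Equiv.Perm.sign w : ℤˣ) : ℤ) * alt s v := by
  rw [alt, alt, ← Matrix.det_permute']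
  rfl

variable [NeZero n]

theorem shifted_strictAnti (m : Weight n k) : StrictAnti (shifted m) := by
  intro a b hab
  rw [shifted_eq, shifted_eq]
  have : m.ell b < m.ell a := m.ell_strictAnti hab
  have : (m.ell b : ℝ) < m.ell a := by exact_mod_cast this
  linarith

theorem shifted_sub_lt (m : Weight n k) (a b : Fin n) : shifted m a - shifted m b < k + n := by
  rw [shifted_eq, shifted_eq]
  have : (m.ell a : ℝ) < k + n := by exact_mod_cast m.ell_lt a
  have : (0 : ℝ) ≤ m.ell b := by positivity
  linarith

theorem shifted_injective : Function.Injective (shifted : Weight n k → Fin n → ℝ) := by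
  intro m p h
  refine Weight.ell_injective (funext fun j => ?_)
  have h1 (j : Fin n) : (m.ell j : ℝ) - ellMean m = p.ell j - ellMean p := by
    rw [← shifted_eq, ← shifted_eq, h]
  have h2 := h1 ⟨n - 1, by have := NeZero.pos n; omega⟩
  simp only [Weight.ell_last] at h2
  have h3 := h1 j
  have : (m.ell j : ℝ) = p.ell j := by linarith
  exact_mod_cast this

/-- The coordinates of σ + ρ spread over less than `k + n`, so the integers `c j` differ pairwise by
at most 1; as they sum to zero, all vanish. Two strictly decreasing vectors with the same values are
then equal. -/
theorem shifted_congr_rigid {s t : Weight n k} {w w' : Equiv.Perm (Fin n)}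
    (h : ∀ j, ∃ c : ℤ, shifted s (w j) - shifted t (w' j) = c * ((k : ℝ) + n)) :
    s = t ∧ w = w' := by
  choose c hc using h
  have hN : (0 : ℝ) < k + n := by
    have : (0 : ℝ) < n := by exact_mod_cast NeZero.pos n
    positivity
  have hsum : ∑ j, c j = 0 := by
    have h1 := Finset.sum_congr (rfl : (Finset.univ : Finset (Fin n)) = _) fun j _ => hc j
    rw [Finset.sum_sub_distrib, Equiv.sum_comp w (shifted s), Equiv.sum_comp w' (shifted t),
      sum_shifted, sum_shifted, ← Finset.sum_mul, sub_zero, eq_comm, mul_eq_zero] at h1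
    have := h1.resolve_right hN.ne'
    exact_mod_cast this
  have hle (a b : Fin n) : c a - c b ≤ 1 := by
    by_contra! hab
    have h1 := shifted_sub_lt s (w a) (w b)
    have h2 := shifted_sub_lt t (w' b) (w' a)
    have h3 : (2 : ℝ) ≤ c a - c b := by exact_mod_cast hab
    have h4 := hc a
    have h5 := hc b
    nlinarith
  have hzero (a : Fin n) : c a = 0 := by
    rcases lt_trichotomy (c a) 0 with h | h | h
    · have := Finset.sum_lt_sum (s := Finset.univ) (f := c) (g := fun _ => 0)
        (fun b _ => by have := hle b a; omega) ⟨a, Finset.mem_univ _, h⟩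
      simp [hsum] at this
    · exact h
    · have := Finset.sum_lt_sum (s := Finset.univ) (f := fun _ => 0) (g := c)
        (fun b _ => by have := hle a b; omega) ⟨a, Finset.mem_univ _, h⟩
      simp [hsum] at this
  have heq (j : Fin n) : shifted s (w j) = shifted t (w' j) := by
    have := hc j
    rw [hzero] at this
    simp at this
    linarith
  have hst : shifted s = shifted t := by
    have h1 : Set.range (fun j => - shifted s j) = Set.range (fun j => - shifted t j) := by
      have e1 : (fun j => - shifted s j) ∘ w = (fun j => - shifted t j) ∘ w' := by
        ext j; simp [heq]
      rw [← w.surjective.range_comp, e1, w'.surjective.range_comp]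
    have h2 := (StrictMono.range_inj (f := fun j => - shifted s j) (g := fun j => - shifted t j)
      (fun a b hab => neg_lt_neg (shifted_strictAnti s hab))
      (fun a b hab => neg_lt_neg (shifted_strictAnti t hab))).1 h1
    ext j
    have := congrFun h2 j
    simpa using this
  refine ⟨shifted_injective hst, Equiv.ext fun j => ?_⟩
  have := heq j
  rw [hst] at this
  exact (shifted_strictAnti t).injective this

open Classical in
theorem sum_phase_intCast_mul (d : ℤ) :
    ∑ x ∈ Finset.range (k + n), phase n k (d * (x : ℝ)) =
      if ∃ c : ℤ, (d : ℝ) = c * ((k : ℝ) + n) then ((k : ℂ) + n) else 0 := by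
  simp only [phase_mul_natCast]
  split_ifs with h
  · rw [(phase_eq_one_iff _).2 h]; simp
  · have h1 : phase n k d ≠ 1 := fun h1 => h ((phase_eq_one_iff _).1 h1)
    rw [geom_sum_eq h1, ← phase_mul_natCast]
    have h2 : phase n k ((d : ℝ) * ((k + n : ℕ) : ℝ)) = 1 :=
      (phase_eq_one_iff _).2 ⟨d, by push_cast; ring⟩
    rw [h2, sub_self, zero_div]

/-- The product of an alternant and the complex conjugate of another one. -/
noncomputable def altPair (s t : Weight n k) (v : Fin n → ℝ) : ℂ := alt s v * alt t (fun j => - v j)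

theorem altPair_add_const (s t : Weight n k) (v : Fin n → ℝ) (c : ℝ) :
    altPair s t (fun j => v j + c) = altPair s t v := by
  rw [altPair, altPair, alt_add_const]
  congr 1
  simp only [neg_add]
  exact alt_add_const t (fun j => - v j) (-c)

omit [NeZero n] in
theorem altPair_comp_perm (s t : Weight n k) (v : Fin n → ℝ) (w : Equiv.Perm (Fin n)) :
    altPair s t (fun j => v (w j)) = altPair s t v := by
  rw [altPair, altPair, alt_comp_perm, alt_comp_perm t (fun j => - v j)]
  have : (((Equiv.Perm.sign w : ℤˣ) : ℤ) : ℂ) * ((Equiv.Perm.sign w : ℤˣ) : ℤ) = 1 := by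
    norm_cast
    simp
  linear_combination (alt s v * alt t fun j => - v j) * this

theorem altPair_shifted (s t m : Weight n k) :
    altPair s t (shifted m) = altPair s t (fun j : Fin n => m.ell j) := by
  rw [← altPair_add_const s t (fun j : Fin n => (m.ell j : ℝ)) (- ellMean m)]
  congr 1; ext j; rw [shifted_eq]; ring

theorem alt_add_level (s : Weight n k) (v : Fin n → ℝ) (i : Fin n) (a : ℝ) (ha : a = 1 ∨ a = -1) :
    alt s (fun j => v j + if j = i then a * ((k : ℝ) + n) else 0) =
      phase n k (a * shifted s 0 * ((k : ℝ) + n)) * alt s v := by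
  have hp (b : Fin n) : phase n k (shifted s b * (a * ((k : ℝ) + n))) =
      phase n k (a * shifted s 0 * ((k : ℝ) + n)) := by
    have h1 := phase_shifted_mul_level s b 0
    rcases ha with rfl | rfl
    · rw [one_mul, one_mul, h1]
    · have h2 (x : ℝ) : phase n k (-x) = (phase n k x)⁻¹ := by
        refine eq_inv_of_mul_eq_one_left ?_
        rw [← phase_add]; simp
      have e1 : shifted s b * (-1 * ((k : ℝ) + n)) = -(shifted s b * ((k : ℝ) + n)) := by ring
      have e2 : -1 * shifted s 0 * ((k : ℝ) + n) = -(shifted s 0 * ((k : ℝ) + n)) := by ring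
      rw [e1, e2, h2, h2, h1]
  have h1 : (Matrix.of fun b j => phase n k (shifted s b *
      (v j + if j = i then a * ((k : ℝ) + n) else 0))) =
      (Matrix.of fun b j => phase n k (shifted s b * v j)).updateCol i
        (phase n k (a * shifted s 0 * ((k : ℝ) + n)) • fun b => phase n k (shifted s b * v i)) := by
    ext b j
    by_cases hj : j = i
    · subst hj
      simp only [Matrix.of_apply, Matrix.updateCol_self, Pi.smul_apply, smul_eq_mul, if_true]
      rw [mul_add, phase_add, hp, mul_comm]
    · simp [hj]
  rw [alt, h1, Matrix.det_updateCol_smul]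
  congr 1
  rw [alt]
  congr 1
  ext b j
  by_cases hj : j = i
  · subst hj; simp
  · simp [hj]

/-- The factor is 1 only if σ + ρ and τ + ρ lie in the same coset of the integers, so it kills the
sum over weights in the remaining case. -/
theorem altPair_rotate (s t m : Weight n k) :
    altPair s t (shifted (Weight.rotate m)) =
      phase n k ((shifted s 0 - shifted t 0) * ((k : ℝ) + n)) * altPair s t (shifted m) := by
  obtain ⟨c, hc⟩ := m.ell_rotate
  have h1 : altPair s t (shifted (Weight.rotate m)) = altPair s t
      (fun j : Fin n => (m.ell (j - 1 : Fin n) : ℝ) + if j = 0 then ((k : ℝ) + n) else 0) := by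
    rw [altPair_shifted, ← altPair_add_const s t _ (c : ℝ)]
    congr 1
    ext j
    have := congrArg (fun x : ℕ => (x : ℝ)) (hc j)
    push_cast at this
    exact this
  have h2 := alt_add_level s (fun j : Fin n => (m.ell (j - 1 : Fin n) : ℝ)) 0 1 (Or.inl rfl)
  have h3 := alt_add_level t (fun j : Fin n => -(m.ell (j - 1 : Fin n) : ℝ)) 0 (-1) (Or.inr rfl)
  have h4 : altPair s t (fun j : Fin n => (m.ell (j - 1 : Fin n) : ℝ)) = altPair s t (shifted m) := by
    rw [altPair_shifted]
    exact altPair_comp_perm s t (fun j : Fin n => (m.ell j : ℝ)) (Equiv.subRight 1)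
  rw [h1, ← h4, altPair, altPair]
  simp only [one_mul] at h2
  rw [h2]
  have e : (fun j : Fin n => -((m.ell (j - 1 : Fin n) : ℝ) + if j = 0 then ((k : ℝ) + n) else 0)) =
      fun j : Fin n => -(m.ell (j - 1 : Fin n) : ℝ) + if j = 0 then -1 * ((k : ℝ) + n) else 0 := by
    ext j; split_ifs <;> ring
  rw [e, h3]
  have e2 : (shifted s 0 - shifted t 0) * ((k : ℝ) + n) =
      shifted s 0 * ((k : ℝ) + n) + -1 * shifted t 0 * ((k : ℝ) + n) := by ring
  rw [e2, phase_add]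
  ring

open Classical in
-- Expanding both alternants gives a double sum over permutations of products of geometric sums, one
-- per free coordinate. Such a product survives only under the congruences of `shifted_congr_rigid`,
-- which force `s = t` and `w = w'`.
theorem sum_altPair_pi (s t : Weight n k) (hint : ∃ d : ℤ, shifted s 0 - shifted t 0 = d)
    (i : Fin n) :
    ∑ f ∈ Fintype.piFinset (fun j : Fin n => if j = i then {0} else Finset.range (k + n)),
      altPair s t (fun j => (f j : ℝ)) =
      if s = t then (n.factorial : ℂ) * ((k : ℂ) + n) ^ (n - 1) else 0 := by
  have hint' (a b : Fin n) : ∃ d : ℤ, shifted s a - shifted t b = d := by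
    obtain ⟨d, hd⟩ := hint
    refine ⟨d + s.ell a - s.ell 0 - t.ell b + t.ell 0, ?_⟩
    rw [shifted_eq, shifted_eq] at hd ⊢
    push_cast
    simp only [Fin.val_zero] at hd
    linarith
  have h1 (f : Fin n → ℕ) : altPair s t (fun j => (f j : ℝ)) =
      ∑ w : Equiv.Perm (Fin n), ∑ w' : Equiv.Perm (Fin n), (((Equiv.Perm.sign w : ℤˣ) : ℤ) *
        ((Equiv.Perm.sign w' : ℤˣ) : ℤ) : ℂ) *
        ∏ j, phase n k ((shifted s (w j) - shifted t (w' j)) * f j) := by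
    rw [altPair, alt_eq_sum, alt_eq_sum, Finset.sum_mul_sum]
    refine Finset.sum_congr rfl fun w _ => Finset.sum_congr rfl fun w' _ => ?_
    rw [← phase_sum, mul_mul_mul_comm, ← phase_add, ← Finset.sum_add_distrib]
    congr 3
    ext j; ring
  have h2 (w w' : Equiv.Perm (Fin n)) :
      ∑ f ∈ Fintype.piFinset (fun j : Fin n => if j = i then {0} else Finset.range (k + n)),
        ∏ j, phase n k ((shifted s (w j) - shifted t (w' j)) * f j) =
      if s = t ∧ w = w' then ((k : ℂ) + n) ^ (n - 1) else 0 := by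
    rw [← Finset.prod_univ_sum (fun j : Fin n => if j = i then {0} else Finset.range (k + n))
      (fun j x => phase n k ((shifted s (w j) - shifted t (w' j)) * (x : ℕ)))]
    have h3 (j : Fin n) (hj : j ≠ i) :
        ∑ x ∈ (if j = i then {0} else Finset.range (k + n)),
          phase n k ((shifted s (w j) - shifted t (w' j)) * (x : ℕ)) =
        if ∃ c : ℤ, shifted s (w j) - shifted t (w' j) = c * ((k : ℝ) + n)
          then ((k : ℂ) + n) else 0 := by
      obtain ⟨d, hd⟩ := hint' (w j) (w' j)
      rw [if_neg hj, hd]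
      exact sum_phase_intCast_mul d
    have h4 : ∑ x ∈ (if i = i then {0} else Finset.range (k + n)),
          phase n k ((shifted s (w i) - shifted t (w' i)) * (x : ℕ)) = 1 := by simp
    rw [← Finset.mul_prod_erase _ _ (Finset.mem_univ i), h4, one_mul]
    split_ifs with h
    · obtain ⟨rfl, rfl⟩ := h
      rw [Finset.prod_congr rfl (g := fun _ => (k : ℂ) + n), Finset.prod_const,
        Finset.card_erase_of_mem (Finset.mem_univ _), Finset.card_univ, Fintype.card_fin]
      intro j hj
      rw [h3 j (Finset.ne_of_mem_erase hj), if_pos ⟨0, by simp⟩]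
    · by_contra hne
      rw [← ne_eq, Finset.prod_ne_zero_iff] at hne
      have h5 (j : Fin n) (hj : j ≠ i) :
          ∃ c : ℤ, shifted s (w j) - shifted t (w' j) = c * ((k : ℝ) + n) := by
        by_contra h6
        exact hne j (Finset.mem_erase.2 ⟨hj, Finset.mem_univ _⟩) (by rw [h3 j hj, if_neg h6])
      refine h (shifted_congr_rigid fun j => ?_)
      by_cases hj : j = i
      · subst hj
        -- The frozen coordinate has no geometric sum; its congruence follows from the others since
        -- all differences sum to zero.
        have h6 : ∑ a, (shifted s (w a) - shifted t (w' a)) = 0 := by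
          rw [Finset.sum_sub_distrib, Equiv.sum_comp w (shifted s), Equiv.sum_comp w' (shifted t),
            sum_shifted, sum_shifted, sub_zero]
        rw [← Finset.add_sum_erase _ _ (Finset.mem_univ j)] at h6
        have h7 : ∃ c : ℤ, ∑ a ∈ Finset.univ.erase j, (shifted s (w a) - shifted t (w' a)) =
            c * ((k : ℝ) + n) := by
          choose! c hc using h5
          refine ⟨∑ a ∈ Finset.univ.erase j, c a, ?_⟩
          push_cast
          rw [Finset.sum_mul]
          exact Finset.sum_congr rfl fun a ha => hc a (Finset.ne_of_mem_erase ha)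
        obtain ⟨c, hc⟩ := h7
        exact ⟨-c, by push_cast; linarith⟩
      · exact h5 j hj
  simp only [h1]
  rw [Finset.sum_comm]
  have h3 (w : Equiv.Perm (Fin n)) :
      ∑ f ∈ Fintype.piFinset (fun j : Fin n => if j = i then {0} else Finset.range (k + n)),
        ∑ w' : Equiv.Perm (Fin n), (((Equiv.Perm.sign w : ℤˣ) : ℤ) *
          ((Equiv.Perm.sign w' : ℤˣ) : ℤ) : ℂ) *
          ∏ j, phase n k ((shifted s (w j) - shifted t (w' j)) * f j) =
      if s = t then ((k : ℂ) + n) ^ (n - 1) else 0 := by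
    rw [Finset.sum_comm]
    simp only [← Finset.mul_sum, h2]
    rw [Finset.sum_eq_single w]
    · have : (((Equiv.Perm.sign w : ℤˣ) : ℤ) : ℂ) * ((Equiv.Perm.sign w : ℤˣ) : ℤ) = 1 := by
        norm_cast
        simp
      rw [this, one_mul]
      simp
    · intro w' _ hw
      rw [if_neg (fun h => hw h.2.symm), mul_zero]
    · exact fun h => absurd (Finset.mem_univ _) h
  simp only [h3, Finset.sum_const, Finset.card_univ, Fintype.card_perm, Fintype.card_fin]
  split_ifs <;> simp

/-- Vectors with a repeated entry contribute zero. An injective one with a zero entry is uniquely a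
permutation of the coordinates of a weight, whose last entry is 0; so `i` is determined and each
weight is counted `n!` times. -/
theorem sum_pi_eq_sum_weight (s t : Weight n k) :
    ∑ i : Fin n, ∑ f ∈ Fintype.piFinset
        (fun j : Fin n => if j = i then {0} else Finset.range (k + n)),
      altPair s t (fun j => (f j : ℝ)) =
      n.factorial * ∑ m : Weight n k, altPair s t (shifted m) := by
  have hn := NeZero.pos n
  have h1 : (n.factorial : ℂ) * ∑ m : Weight n k, altPair s t (shifted m) =
      ∑ x : Equiv.Perm (Fin n) × Weight n k, altPair s t (fun j : Fin n => (x.2.ell (x.1 j) : ℝ)) := by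
    rw [Fintype.sum_prod_type]
    have (w : Equiv.Perm (Fin n)) (m : Weight n k) :
        altPair s t (fun j : Fin n => (m.ell (w j) : ℝ)) = altPair s t (shifted m) := by
      rw [altPair_shifted]
      exact altPair_comp_perm s t (fun j : Fin n => (m.ell j : ℝ)) w
    simp [this, Fintype.card_perm]
  rw [h1, Finset.sum_sigma']
  symm
  let z : Fin n := ⟨n - 1, by omega⟩
  refine Finset.sum_of_injOn
    (fun x : Equiv.Perm (Fin n) × Weight n k =>
      (⟨x.1.symm z, fun j => x.2.ell (x.1 j)⟩ : (_ : Fin n) × (Fin n → ℕ))) ?_ ?_ ?_ ?_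
  · rintro ⟨w, m⟩ _ ⟨w', m'⟩ _ h
    have h2 : (fun j : Fin n => m.ell (w j)) = fun j : Fin n => m'.ell (w' j) := by
      have := congrArg Sigma.snd h
      exact this
    have h3 : Set.range (fun j : Fin n => -(m.ell j : ℤ)) = Set.range fun j : Fin n => -(m'.ell j : ℤ) := by
      have e1 : (fun j : Fin n => -(m.ell j : ℤ)) ∘ w = (fun j : Fin n => -(m'.ell j : ℤ)) ∘ w' := by
        ext j
        have : m.ell (w j) = m'.ell (w' j) := congrFun h2 j
        simp only [Function.comp_apply, this]
      rw [← w.surjective.range_comp, e1, w'.surjective.range_comp]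
    have h4 := (StrictMono.range_inj
      (fun a b hab => neg_lt_neg (Int.ofNat_lt.2 (m.ell_strictAnti hab)))
      (fun a b hab => neg_lt_neg (Int.ofNat_lt.2 (m'.ell_strictAnti hab)))).1 h3
    have h5 : m = m' := by
      refine Weight.ell_injective (funext fun j => ?_)
      exact Nat.cast_injective (R := ℤ) (neg_injective (congrFun h4 j))
    subst h5
    refine Prod.ext (Equiv.ext fun j => ?_) rfl
    exact m.ell_strictAnti.injective (congrFun h2 j)
  · rintro ⟨w, m⟩ _
    simp only [Finset.coe_sigma, Set.mem_sigma_iff, Finset.mem_coe, Finset.mem_univ, true_and,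
      Fintype.mem_piFinset]
    intro j
    split_ifs with hj
    · subst hj
      rw [Equiv.apply_symm_apply, Finset.mem_singleton]
      exact m.ell_last
    · exact Finset.mem_range.2 (m.ell_lt _)
  · rintro ⟨i, f⟩ hif hnot
    simp only [Finset.mem_sigma, Finset.mem_univ, true_and, Fintype.mem_piFinset] at hif
    by_contra hne
    have hinj : Function.Injective f := by
      intro a b hab
      by_contra hne'
      exact hne (by simp only [altPair]; rw [alt_eq_zero s _ hne' (by simp [hab]), zero_mul])
    have hi0 : f i = 0 := by simpa using hif i
    have hlt (j : Fin n) : f j < k + n := by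
      by_cases hj : j = i
      · subst hj; omega
      · simpa [hj] using hif j
    apply hnot
    have hmono : StrictMono (f ∘ Tuple.sort f) :=
      (Tuple.monotone_sort f).strictMono_of_injective (hinj.comp (Tuple.sort f).injective)
    obtain ⟨m, hm⟩ := Weight.exists_ell_eq (k := k)
      (e := fun j => f (Tuple.sort f (Fin.rev j)))
      (fun a b hab => hmono (Fin.rev_lt_rev.2 hab)) (fun j => hlt _)
      ⟨Fin.rev ((Tuple.sort f).symm i), by simp [hi0]⟩
    have hmf (j : Fin n) : m.ell (((Tuple.sort f).symm.trans Fin.revPerm) j : Fin n) = f j := by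
      rw [hm]; simp
    refine ⟨((Tuple.sort f).symm.trans Fin.revPerm, m), by simp, ?_⟩
    have e1 : (fun j => m.ell (((Tuple.sort f).symm.trans Fin.revPerm) j : Fin n)) = f := funext hmf
    have e2 : ((Tuple.sort f).symm.trans Fin.revPerm).symm z = i := by
      apply hinj
      rw [hi0, ← hmf, Equiv.apply_symm_apply]
      exact m.ell_last
    simp only [e1, e2]
  · rintro ⟨w, m⟩ _
    rfl

/-- Orthogonality of the alternants over the weights of level `k`. -/
theorem sum_altPair (s t : Weight n k) :
    ∑ m : Weight n k, altPair s t (shifted m) =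
      if s = t then (n : ℂ) * ((k : ℂ) + n) ^ (n - 1) else 0 := by
  -- Coordinate differences of σ and τ need not be integers. If they are, the geometric sums apply;
  -- if not, rotation multiplies the sum by a phase different from 1.
  by_cases hint : ∃ d : ℤ, shifted s 0 - shifted t 0 = d
  · have h1 := sum_pi_eq_sum_weight s t
    simp only [sum_altPair_pi s t hint, Finset.sum_const, Finset.card_univ, Fintype.card_fin] at h1
    have h2 : (n.factorial : ℂ) ≠ 0 := by exact_mod_cast n.factorial_ne_zero
    apply mul_left_cancel₀ h2
    rw [← h1]
    split_ifs
    · simp; ring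
    · simp
  · have hst : s ≠ t := by
      rintro rfl
      exact hint ⟨0, by simp⟩
    rw [if_neg hst]
    have h1 : ∑ m : Weight n k, altPair s t (shifted m) =
        phase n k ((shifted s 0 - shifted t 0) * ((k : ℝ) + n)) *
          ∑ m : Weight n k, altPair s t (shifted m) := by
      conv_lhs => rw [← Equiv.sum_comp Weight.rotate]
      rw [Finset.mul_sum]
      exact Finset.sum_congr rfl fun m _ => altPair_rotate s t m
    have h2 : phase n k ((shifted s 0 - shifted t 0) * ((k : ℝ) + n)) ≠ 1 := by
      rw [Ne, phase_eq_one_iff]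
      rintro ⟨a, ha⟩
      have hN : (k : ℝ) + n ≠ 0 := by
        have : (0 : ℝ) < n := by exact_mod_cast NeZero.pos n
        positivity
      exact hint ⟨a, mul_right_cancel₀ hN ha⟩
    have h3 : (1 - phase n k ((shifted s 0 - shifted t 0) * ((k : ℝ) + n))) *
        ∑ m : Weight n k, altPair s t (shifted m) = 0 := by linear_combination h1
    exact (mul_eq_zero.1 h3).resolve_left (sub_ne_zero.2 h2.symm)

end Orthogonality
end AffineFusion

namespace AffineFusion

/-! ### Unitarity of the S-matrix -/

section SMatrix

variable {n k : ℕ}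

/-- The normalisation factor of the `S`-matrix. -/
noncomputable def sNorm (n k : ℕ) : ℂ :=
  Complex.exp (Complex.I * Real.pi * n * (n - 1) / 4) /
    (Real.sqrt ((n : ℝ) * ((k : ℝ) + n) ^ (n - 1)) : ℂ)

theorem modularS_eq (m s : Weight n k) : modularS m s = sNorm n k * alt s (shifted m) := by
  rw [modularS, sNorm, alt_eq_sum]
  congr 1
  refine Finset.sum_congr rfl fun w _ => ?_
  rw [phase, ← Equiv.sum_comp w (fun j => shifted s j * shifted m (w⁻¹ j))]
  simp

theorem sign_revPerm : ((Equiv.Perm.sign (Fin.revPerm : Equiv.Perm (Fin n)) : ℤˣ) : ℤ) =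
    (-1) ^ (n * (n - 1) / 2) := by
  rw [Equiv.Perm.sign_eq_prod_prod_Ioi]
  have h1 (i : Fin n) : ∏ j ∈ Finset.Ioi i,
      (if (Fin.revPerm i : Fin n) < Fin.revPerm j then 1 else -1 : ℤˣ) = (-1) ^ (n - 1 - (i : ℕ)) := by
    rw [Finset.prod_congr rfl (g := fun _ => -1), Finset.prod_const, Fin.card_Ioi]
    intro j hj
    rw [if_neg]
    simpa using (Finset.mem_Ioi.1 hj).le
  simp only [h1]
  rw [Finset.prod_pow_eq_pow_sum, ← Equiv.sum_comp Fin.revPerm]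
  have h2 : ∑ j : Fin n, (n - 1 - (Fin.revPerm j : ℕ)) = n * (n - 1) / 2 := by
    rw [← Finset.sum_range_id, Finset.sum_range]
    refine Finset.sum_congr rfl fun i _ => ?_
    simp only [Fin.revPerm_apply, Fin.val_rev]
    omega
  rw [h2]
  simp

variable [NeZero n]

/-- Up to a constant vector, λ* + ρ is -w₀(λ + ρ), and the sign is that of the longest permutation
w₀. -/
theorem alt_flip (t m : Weight n k) : alt t (shifted m.flip) =
    (-1) ^ (n * (n - 1) / 2) * alt t (fun j => - shifted m j) := by
  have h1 (j : Fin n) : shifted m.flip j = - shifted m (Fin.revPerm j) +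
      (((m.row 0 + (n - 1) : ℕ) : ℝ) - ellMean m - ellMean m.flip) := by
    rw [← m.ell_flip j, shifted_eq, shifted_eq, Fin.revPerm_apply]
    push_cast
    ring
  rw [funext h1, alt_add_const t (fun j => - shifted m (Fin.revPerm j)),
    alt_comp_perm t (fun j => - shifted m j), sign_revPerm]
  push_cast
  rfl

/-- The squared phase factor is the sign of w₀, which cancels the sign in `alt_flip`; the square
root cancels the norm in `sum_altPair`. -/
theorem sNorm_sq : sNorm n k * sNorm n k * (-1) ^ (n * (n - 1) / 2) *
    ((n : ℂ) * ((k : ℂ) + n) ^ (n - 1)) = 1 := by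
  have hn := NeZero.pos n
  have h1 : (Real.sqrt ((n : ℝ) * ((k : ℝ) + n) ^ (n - 1)) : ℂ) *
      Real.sqrt ((n : ℝ) * ((k : ℝ) + n) ^ (n - 1)) = (n : ℂ) * ((k : ℂ) + n) ^ (n - 1) := by
    rw [← Complex.ofReal_mul, Real.mul_self_sqrt (by positivity)]
    push_cast; rfl
  have h2 : (n : ℂ) * ((k : ℂ) + n) ^ (n - 1) ≠ 0 := by
    have h3 : (n : ℂ) ≠ 0 := NeZero.ne _
    have h4 : (k : ℂ) + n ≠ 0 := by exact_mod_cast (by omega : k + n ≠ 0)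
    exact mul_ne_zero h3 (pow_ne_zero _ h4)
  have h3 : Complex.exp (Complex.I * Real.pi * n * (n - 1) / 4) *
      Complex.exp (Complex.I * Real.pi * n * (n - 1) / 4) = (-1) ^ (n * (n - 1) / 2) := by
    rw [← Complex.exp_add, ← Complex.exp_pi_mul_I, ← Complex.exp_nat_mul]
    congr 1
    have h4 : 2 * (n * (n - 1) / 2) = n * (n - 1) :=
      Nat.mul_div_cancel' (Nat.even_mul_pred_self n).two_dvd
    have h5 := congrArg (fun x : ℕ => (x : ℂ)) h4
    push_cast [Nat.cast_sub (show 1 ≤ n from hn)] at h5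
    linear_combination -(Complex.I * Real.pi / 2) * h5
  rw [sNorm, div_mul_div_comm, h1, h3]
  have h4 : ((-1 : ℂ) ^ (n * (n - 1) / 2)) * (-1) ^ (n * (n - 1) / 2) = 1 := by
    rw [← mul_pow]; simp
  rw [div_mul_eq_mul_div, h4, one_div, inv_mul_cancel₀ h2]

/-- Unitarity of the `S`-matrix. -/
theorem sum_modularS_mul_flip (s t : Weight n k) :
    ∑ q : Weight n k, modularS q s * modularS q.flip t = if s = t then 1 else 0 := by
  have h1 (q : Weight n k) : modularS q s * modularS q.flip t =
      sNorm n k * sNorm n k * (-1) ^ (n * (n - 1) / 2) * altPair s t (shifted q) := by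
    rw [modularS_eq, modularS_eq, alt_flip, altPair]
    ring
  simp only [h1]
  rw [← Finset.mul_sum, sum_altPair]
  split_ifs
  · exact sNorm_sq
  · simp

theorem Weight.row_zero (j : ℕ) : (Weight.zero n k).row j = 0 := by
  refine Finset.sum_eq_zero fun i _ => ?_
  split_ifs with h
  · have : i ≠ 0 := fun hi => by subst hi; simp at h
    simp [Weight.zero, this]
  · rfl

theorem point_injective (s : Weight n k) : Function.Injective (point s) := by
  intro a b hab
  have h1 : phase n k (shifted s a - shifted s b) = 1 := by
    have h2 : phase n k (shifted s a - shifted s b) * phase n k (shifted s b) =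
        phase n k (shifted s b) := by
      rw [← phase_add, sub_add_cancel]; exact hab
    exact mul_right_cancel₀ (phase_ne_zero _) (h2.trans (one_mul _).symm)
  obtain ⟨c, hc⟩ := (phase_eq_one_iff _).1 h1
  have hN : (0 : ℝ) < k + n := by
    have : (0 : ℝ) < n := by exact_mod_cast NeZero.pos n
    positivity
  have h2 := shifted_sub_lt s a b
  have h3 := shifted_sub_lt s b a
  have h4 : c < 1 := by
    by_contra! h
    have : (1 : ℝ) ≤ c := by exact_mod_cast h
    nlinarith
  have h5 : -1 < c := by
    by_contra! h
    have : (c : ℝ) ≤ -1 := by exact_mod_cast h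
    nlinarith
  have h6 : c = 0 := by omega
  rw [h6] at hc
  simp only [Int.cast_zero, zero_mul, sub_eq_zero] at hc
  exact (shifted_strictAnti s).injective hc

theorem det_point_pow (s : Weight n k) :
    (Matrix.of fun i j : Fin n => point s i ^ (n - 1 - (j : ℕ))).det =
      alt s (shifted (Weight.zero n k)) := by
  rw [alt_shifted]
  simp [Weight.ell, Weight.row_zero]

/-- Weyl's denominator is a Vandermonde determinant at distinct points. -/
theorem alt_zero_ne_zero (s : Weight n k) : alt s (shifted (Weight.zero n k)) ≠ 0 := by
  rw [← det_point_pow]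
  have h1 : (Matrix.of fun i j : Fin n => point s i ^ (n - 1 - (j : ℕ))) =
      (Matrix.vandermonde (point s)).submatrix id Fin.revPerm := by
    ext i j
    simp only [Matrix.of_apply, Matrix.submatrix_apply, Matrix.vandermonde_apply, id,
      Fin.revPerm_apply, Fin.val_rev]
    congr 1
    omega
  rw [h1, Matrix.det_permute']
  refine mul_ne_zero (by simp) (Matrix.det_vandermonde_ne_zero_iff.2 (point_injective s))

theorem sNorm_ne_zero : sNorm n k ≠ 0 := by
  intro h
  have := sNorm_sq (n := n) (k := k)
  simp [h] at this

end SMatrix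

/-! ### Characters of the two products and their comparison -/

section Characters

variable {n k : ℕ} [NeZero n]

theorem det_esymmInt_eq (s : Weight n k) {t : ℂ} (ht : t ≠ 0) {f : ℕ → ℕ} (hf : Antitone f) :
    (Matrix.of fun i j : Fin ((diagramOfRows n f hf).rowLen 0) =>
      esymmInt (fun i => t * point s i)
        (((diagramOfRows n f hf).colLen i : ℤ) - (i : ℤ) + (j : ℤ))).det *
      alt s (shifted (Weight.zero n k)) =
      t ^ (∑ j : Fin n, f j) * alt s (fun j : Fin n => ((f j + (n - 1 - (j : ℕ)) : ℕ) : ℝ)) := by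
  have h1 := det_esymmInt_mul_alternant (n := n) hf (fun i => t * point s i)
  have h2 (e : Fin n → ℕ) : (Matrix.of fun i j : Fin n => (t * point s i) ^ e j).det =
      t ^ (∑ j, e j) * (Matrix.of fun i j : Fin n => point s i ^ e j).det := by
    rw [← Finset.prod_pow_eq_pow_sum, ← Matrix.det_mul_row]
    simp only [mul_pow, Matrix.of_apply]
  rw [h2, h2, det_point_pow] at h1
  rw [alt_natCast]
  apply mul_left_cancel₀ (pow_ne_zero (∑ j : Fin n, (n - 1 - (j : ℕ))) ht)
  rw [Finset.sum_add_distrib, pow_add] at h1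
  linear_combination h1

/-- The eigenvalue is the Schur polynomial at the `t * point s i`, a quotient of alternants. The
`m₀` full columns shift all coordinates equally, which leaves the alternant unchanged and shows only
in the power of `t`. -/
theorem isLeftEigen_schur_affineDiagram (hn : 2 ≤ n) (s l : Weight n k) {t : ℂ} (ht : t ≠ 0) :
    IsLeftEigen (eigenCoeff s t) (schur n k (t ^ n) l.affineDiagram)
      (eigenCoeff s t l / alt s (shifted (Weight.zero n k))) := by
  have h1 := isLeftEigen_schur hn s t l.affineDiagram
  convert h1 using 1
  rw [div_eq_iff (alt_zero_ne_zero s)]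
  refine Eq.trans ?_ (det_esymmInt_eq s ht l.affineRow_antitone).symm
  rw [l.sum_affineRow, eigenCoeff]
  congr 1
  rw [← alt_add_const s _ (ellMean l + l.1 0)]
  congr 1
  ext j
  rw [shifted_eq, Weight.ell, Weight.affineRow, if_pos j.2]
  push_cast
  ring

theorem isLeftEigen_schur_diagram (hn : 2 ≤ n) (s l : Weight n k) :
    IsLeftEigen (eigenCoeff s 1) (schur n k 1 l.diagram)
      (eigenCoeff s 1 l / alt s (shifted (Weight.zero n k))) := by
  have h1 := isLeftEigen_schur hn s 1 l.diagram
  rw [one_pow] at h1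
  convert h1 using 1
  rw [div_eq_iff (alt_zero_ne_zero s)]
  refine Eq.trans ?_ (det_esymmInt_eq s one_ne_zero l.row_antitone).symm
  rw [eigenCoeff, one_pow, one_pow]
  congr 1
  rw [← alt_add_const s _ (ellMean l)]
  congr 1
  ext j
  rw [shifted_eq, Weight.ell]
  ring

/-- The left eigenvectors separate points. -/
theorem ext_of_eigenCoeff_dotProduct {t : ℂ} (ht : t ≠ 0) {f g : Weight n k → ℂ}
    (h : ∀ s, eigenCoeff s t ⬝ᵥ f = eigenCoeff s t ⬝ᵥ g) : f = g := by
  let A : Matrix (Weight n k) (Weight n k) ℂ := Matrix.of fun s q => modularS q s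
  let B : Matrix (Weight n k) (Weight n k) ℂ := Matrix.of fun q s => modularS q.flip s
  -- Unitarity gives a one-sided inverse, hence a two-sided one for square matrices; the powers of
  -- `t` form an invertible diagonal factor.
  have hAB : A * B = 1 := by
    ext s u
    rw [Matrix.mul_apply, Matrix.one_apply]
    exact sum_modularS_mul_flip s u
  have hBA : B * A = 1 := mul_eq_one_comm.1 hAB
  have h1 (f : Weight n k → ℂ) (s : Weight n k) : (A.mulVec fun q => t ^ q.degree * f q) s =
      sNorm n k * (eigenCoeff s t ⬝ᵥ f) := by
    simp only [Matrix.mulVec, dotProduct, A, Matrix.of_apply, modularS_eq, eigenCoeff,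
      Finset.mul_sum]
    exact Finset.sum_congr rfl fun q _ => by ring
  have h2 : (A.mulVec fun q => t ^ q.degree * f q) = A.mulVec fun q => t ^ q.degree * g q := by
    ext s
    rw [h1, h1, h]
  have h3 := congrArg B.mulVec h2
  rw [Matrix.mulVec_mulVec, Matrix.mulVec_mulVec, hBA, Matrix.one_mulVec, Matrix.one_mulVec] at h3
  ext q
  exact mul_left_cancel₀ (pow_ne_zero _ ht) (congrFun h3 q)

theorem end_eq_of_isLeftEigen {t : ℂ} (ht : t ≠ 0) {S T : Module.End ℂ (Weight n k → ℂ)}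
    {c : Weight n k → ℂ} (hS : ∀ s, IsLeftEigen (eigenCoeff s t) S (c s))
    (hT : ∀ s, IsLeftEigen (eigenCoeff s t) T (c s)) : S = T :=
  LinearMap.ext fun v => ext_of_eigenCoeff_dotProduct ht fun s => by rw [hS, hT]

theorem commute_elem_pow (hn : 2 ≤ n) {t : ℂ} (ht : t ≠ 0) (r r' : ℤ) :
    Commute (elem n k (t ^ n) r) (elem n k (t ^ n) r') := by
  refine end_eq_of_isLeftEigen ht
    (fun s => (isLeftEigen_elem hn s t r).mul (isLeftEigen_elem hn s t r')) fun s => ?_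
  rw [mul_comm]
  exact (isLeftEigen_elem hn s t r').mul (isLeftEigen_elem hn s t r)

theorem combMul_apply {R : Type} [CommRing R] (z : R) (f g : Weight n k → R) :
    combMul n k z f g = ∑ m, f m • schur n k z m.affineDiagram g := by
  simp [combMul, LinearMap.sum_apply]

/-- Divided by `alt s (shifted (Weight.zero n k))`, the eigenfunctional is a character of ⊛. -/
theorem eigenCoeff_dotProduct_combMul (hn : 2 ≤ n) (s : Weight n k) {t : ℂ} (ht : t ≠ 0)
    (f g : Weight n k → ℂ) :
    eigenCoeff s t ⬝ᵥ combMul n k (t ^ n) f g =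
      (eigenCoeff s t ⬝ᵥ f) * (eigenCoeff s t ⬝ᵥ g) / alt s (shifted (Weight.zero n k)) := by
  rw [combMul_apply, dotProduct_sum]
  have h1 (m : Weight n k) : eigenCoeff s t ⬝ᵥ (f m • schur n k (t ^ n) m.affineDiagram g) =
      eigenCoeff s t m * f m *
        ((eigenCoeff s t ⬝ᵥ g) / alt s (shifted (Weight.zero n k))) := by
    rw [dotProduct_smul, isLeftEigen_schur_affineDiagram hn s m ht, smul_eq_mul]
    ring
  simp only [h1]
  rw [← Finset.sum_mul, mul_div_assoc]
  rfl

/-- Pairing the Verlinde formula with a column of the S-matrix collapses its sum to one term by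
unitarity. The resulting character is the one found for ⊛ at `t = 1`. -/
theorem eigenCoeff_dotProduct_fusionMul (s : Weight n k) (f g : Weight n k → ℂ) :
    eigenCoeff s 1 ⬝ᵥ fusionMul f g =
      (eigenCoeff s 1 ⬝ᵥ f) * (eigenCoeff s 1 ⬝ᵥ g) / alt s (shifted (Weight.zero n k)) := by
  have hN := sNorm_ne_zero (n := n) (k := k)
  have hS (p : Weight n k) : eigenCoeff s 1 p = (sNorm n k)⁻¹ * modularS p s := by
    rw [modularS_eq, eigenCoeff, one_pow, one_mul, inv_mul_cancel_left₀ hN]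
  have h1 (m p : Weight n k) : ∑ q, modularS q s * fusionCoeff m p q =
      modularS m s * modularS p s / modularS (Weight.zero n k) s := by
    simp only [fusionCoeff, Finset.mul_sum]
    rw [Finset.sum_comm]
    have h2 (u : Weight n k) : ∑ q : Weight n k, modularS q s *
        (modularS m u * modularS p u * modularS q.flip u / modularS (Weight.zero n k) u) =
        modularS m u * modularS p u / modularS (Weight.zero n k) u * if s = u then 1 else 0 := by
      rw [← sum_modularS_mul_flip, Finset.mul_sum]
      exact Finset.sum_congr rfl fun q _ => by ring
    simp only [h2]
    simp
  have h2 : eigenCoeff s 1 ⬝ᵥ fusionMul f g = (sNorm n k)⁻¹ * ∑ m, ∑ p, f m * g p *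
      (modularS m s * modularS p s / modularS (Weight.zero n k) s) := by
    simp only [dotProduct, fusionMul, hS, ← h1, Finset.mul_sum]
    rw [Finset.sum_comm]
    refine Finset.sum_congr rfl fun m _ => ?_
    rw [Finset.sum_comm]
    refine Finset.sum_congr rfl fun p _ => Finset.sum_congr rfl fun q _ => ?_
    ring
  have h3 : alt s (shifted (Weight.zero n k)) = (sNorm n k)⁻¹ * modularS (Weight.zero n k) s := by
    rw [modularS_eq, inv_mul_cancel_left₀ hN]
  have h4 : modularS (Weight.zero n k) s ≠ 0 := by
    rw [modularS_eq]; exact mul_ne_zero hN (alt_zero_ne_zero s)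
  rw [h2, h3]
  simp only [dotProduct, hS]
  rw [Finset.sum_mul_sum, Finset.mul_sum, Finset.sum_div]
  refine Finset.sum_congr rfl fun m _ => ?_
  rw [Finset.mul_sum, Finset.sum_div]
  refine Finset.sum_congr rfl fun p _ => ?_
  field_simp

theorem combMul_pow_comm (hn : 2 ≤ n) {t : ℂ} (ht : t ≠ 0) (f g : Weight n k → ℂ) :
    combMul n k (t ^ n) f g = combMul n k (t ^ n) g f :=
  ext_of_eigenCoeff_dotProduct ht fun s => by
    rw [eigenCoeff_dotProduct_combMul hn s ht, eigenCoeff_dotProduct_combMul hn s ht]; ring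

theorem combMul_pow_assoc (hn : 2 ≤ n) {t : ℂ} (ht : t ≠ 0) (f g h : Weight n k → ℂ) :
    combMul n k (t ^ n) (combMul n k (t ^ n) f g) h =
      combMul n k (t ^ n) f (combMul n k (t ^ n) g h) :=
  ext_of_eigenCoeff_dotProduct ht fun s => by
    simp only [eigenCoeff_dotProduct_combMul hn s ht]; ring

theorem fusionMul_eq_combMul (hn : 2 ≤ n) (f g : Weight n k → ℂ) :
    fusionMul f g = combMul n k 1 f g :=
  ext_of_eigenCoeff_dotProduct one_ne_zero fun s => by
    have := eigenCoeff_dotProduct_combMul hn s one_ne_zero f g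
    rw [one_pow] at this
    rw [eigenCoeff_dotProduct_fusionMul, this]

theorem eigenCoeff_dotProduct_single_zero (s : Weight n k) :
    eigenCoeff s 1 ⬝ᵥ Pi.single (Weight.zero n k) 1 = alt s (shifted (Weight.zero n k)) := by
  simp [eigenCoeff]

theorem fusionMul_zero_weight (f : Weight n k → ℂ) :
    fusionMul (Pi.single (Weight.zero n k) 1) f = f ∧
      fusionMul f (Pi.single (Weight.zero n k) 1) = f := by
  constructor <;> refine ext_of_eigenCoeff_dotProduct one_ne_zero fun s => ?_ <;>
  · have := alt_zero_ne_zero s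
    rw [eigenCoeff_dotProduct_fusionMul, eigenCoeff_dotProduct_single_zero]
    field_simp

theorem schur_affineDiagram_eq_diagram (hn : 2 ≤ n) (l : Weight n k) :
    schur n k (1 : ℂ) l.affineDiagram = schur n k 1 l.diagram := by
  refine end_eq_of_isLeftEigen one_ne_zero (fun s => ?_) fun s => isLeftEigen_schur_diagram hn s l
  have := isLeftEigen_schur_affineDiagram hn s l one_ne_zero
  rwa [one_pow] at this

end Characters
end AffineFusion

namespace AffineFusion

/-! ### Compatibility with ring homomorphisms -/

section BaseChange

variable {n k : ℕ} {R S : Type} [CommRing R] [CommRing S]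

/-- The endomorphism `T'` is obtained from `T` by applying `φ` to the matrix entries. -/
def IsBaseChange (φ : R →+* S) (T : Module.End R (Weight n k → R))
    (T' : Module.End S (Weight n k → S)) : Prop :=
  ∀ v : Weight n k → R, φ ∘ T v = T' (φ ∘ v)

namespace IsBaseChange

variable {φ : R →+* S}

theorem smul_one (z : R) :
    IsBaseChange φ (z • 1 : Module.End R (Weight n k → R)) (φ z • 1) := fun v => by
  ext q; simp

theorem zero : IsBaseChange φ (0 : Module.End R (Weight n k → R)) 0 := fun v => by
  ext q; simp

theorem zsmul {T : Module.End R (Weight n k → R)} {T' : Module.End S (Weight n k → S)}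
    (h : IsBaseChange φ T T') (a : ℤ) : IsBaseChange φ (a • T) (a • T') := fun v => by
  rw [LinearMap.smul_apply, LinearMap.smul_apply, ← h v]
  ext q; simp

theorem mul {T U : Module.End R (Weight n k → R)} {T' U' : Module.End S (Weight n k → S)}
    (hT : IsBaseChange φ T T') (hU : IsBaseChange φ U U') : IsBaseChange φ (T * U) (T' * U') :=
  fun v => by rw [Module.End.mul_apply, Module.End.mul_apply, hT, hU]

theorem sum {ι : Type} (s : Finset ι) {T : ι → Module.End R (Weight n k → R)}
    {T' : ι → Module.End S (Weight n k → S)} (h : ∀ i ∈ s, IsBaseChange φ (T i) (T' i)) :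
    IsBaseChange φ (∑ i ∈ s, T i) (∑ i ∈ s, T' i) := fun v => by
  rw [LinearMap.sum_apply, LinearMap.sum_apply, ← Finset.sum_congr rfl fun i hi => h i hi v]
  ext q; simp [Finset.sum_apply]

theorem list_prod {ι : Type} (L : List ι) {T : ι → Module.End R (Weight n k → R)}
    {T' : ι → Module.End S (Weight n k → S)} (h : ∀ i, IsBaseChange φ (T i) (T' i)) :
    IsBaseChange φ (L.map T).prod (L.map T').prod := by
  induction L with
  | nil => simpa using smul_one (φ := φ) (n := n) (k := k) 1
  | cons a L ih => simpa using (h a).mul ih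

variable [NeZero n]

theorem hop (φ : R →+* S) (z : R) (i : Fin n) :
    IsBaseChange φ (hop n k z i) (hop n k (φ z) i) := fun v => by
  ext q
  simp only [AffineFusion.hop, Matrix.toLin'_apply, Matrix.mulVec, dotProduct, Matrix.of_apply,
    Function.comp_apply, map_sum, map_mul, apply_ite φ, map_one, map_zero]

theorem elem (φ : R →+* S) (z : R) (r : ℤ) :
    IsBaseChange φ (elem n k z r) (elem n k (φ z) r) := by
  cases r with
  | negSucc r => exact zero
  | ofNat r =>
    simp only [AffineFusion.elem]
    split_ifs
    · exact smul_one z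
    · exact sum _ fun I _ => list_prod _ fun i => hop φ z i

theorem schur (φ : R →+* S) (z : R) (Y : YoungDiagram) :
    IsBaseChange φ (schur n k z Y) (schur n k (φ z) Y) := by
  refine sum _ fun w _ => zsmul ?_ _
  rw [List.ofFn_eq_map, List.ofFn_eq_map]
  exact list_prod _ fun i => elem φ z _

end IsBaseChange

theorem comp_combMul [NeZero n] (φ : R →+* S) (z : R) (f g : Weight n k → R) :
    φ ∘ combMul n k z f g = combMul n k (φ z) (φ ∘ f) (φ ∘ g) := by
  rw [combMul_apply, combMul_apply]
  simp only [← IsBaseChange.schur φ z _ g]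
  ext q
  simp [Finset.sum_apply]

end BaseChange

/-! ### From z = tⁿ to the generic parameter -/

section Generic

open Polynomial

variable {n k : ℕ} [NeZero n]

omit [NeZero n] in
-- Every nonzero complex number is an `n`-th power, so the hypothesis covers infinitely many points.
theorem polynomial_family_ext (hn : 2 ≤ n) {f g : Weight n k → ℂ[X]}
    (h : ∀ t : ℂ, t ≠ 0 → evalRingHom (t ^ n) ∘ f = evalRingHom (t ^ n) ∘ g) : f = g := by
  ext1 q
  refine Polynomial.eq_of_infinite_eval_eq _ _ ?_
  refine Set.Infinite.mono ?_ (Set.Infinite.sdiff (Set.infinite_univ (α := ℂ)) (Set.finite_singleton 0))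
  rintro x ⟨-, hx⟩
  obtain ⟨t, rfl⟩ := IsAlgClosed.exists_pow_nat_eq x (show 0 < n by omega)
  have ht : t ≠ 0 := by
    rintro rfl
    exact hx (by simp; omega)
  exact congrFun (h t ht) q

theorem commute_elem_X (hn : 2 ≤ n) (r s : ℤ) :
    Commute (elem n k (X : ℂ[X]) r) (elem n k (X : ℂ[X]) s) := by
  refine LinearMap.ext fun v => polynomial_family_ext hn fun t ht => ?_
  have h (r : ℤ) := IsBaseChange.elem (n := n) (k := k) (evalRingHom (t ^ n)) (X : ℂ[X]) r
  simp only [coe_evalRingHom, eval_X] at h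
  rw [((h r).mul (h s)) v, ((h s).mul (h r)) v, (commute_elem_pow hn ht r s).eq]

theorem comp_evalRingHom_combMul (t : ℂ) (f g : Weight n k → ℂ[X]) :
    evalRingHom t ∘ combMul n k X f g =
      combMul n k t (evalRingHom t ∘ f) (evalRingHom t ∘ g) := by
  rw [comp_combMul, coe_evalRingHom, eval_X]

theorem combMul_X_comm (hn : 2 ≤ n) (f g : Weight n k → ℂ[X]) :
    combMul n k X f g = combMul n k X g f :=
  polynomial_family_ext hn fun t ht => by
    rw [comp_evalRingHom_combMul, comp_evalRingHom_combMul, combMul_pow_comm hn ht]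

theorem combMul_X_assoc (hn : 2 ≤ n) (f g h : Weight n k → ℂ[X]) :
    combMul n k X (combMul n k X f g) h = combMul n k X f (combMul n k X g h) :=
  polynomial_family_ext hn fun t ht => by
    simp only [comp_evalRingHom_combMul, combMul_pow_assoc hn ht]

end Generic

/-! ### The quotient by z - 1 as evaluation at 1 -/

section Specialisation

open Polynomial

variable {n k : ℕ} [NeZero n]

/-- A surjective multiplicative map killing exactly the families that vanish at `z = 1` identifies
its target with the specialisation of the generic combinatorial algebra. -/
theorem exists_specialisation_ringEquiv {K : Type} [CommRing K] {A : Type}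
    [NonUnitalNonAssocRing A] (ev : CombAlg n k K[X] X →ₙ+* A) (hsurj : Function.Surjective ev)
    (hker : ∀ f, ev f = 0 ↔ ∀ m, (f.coeff m).eval 1 = 0) :
    ∃ φ : CombAlgSpec n k K ≃+* A, ∀ f : CombAlg n k K[X] X, φ (f : CombAlgSpec n k K) = ev f := by
  have hmem (f : CombAlg n k K[X] X) : f ∈ idealZSubOne n k K ↔ ev f = 0 := by
    constructor
    · intro hf
      have hle : idealZSubOne n k K ≤ TwoSidedIdeal.ker ev := by
        refine TwoSidedIdeal.span_le.2 ?_
        rintro _ ⟨g, rfl⟩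
        rw [SetLike.mem_coe, TwoSidedIdeal.mem_ker, hker]
        intro m
        change ((X - 1) * g.coeff m).eval 1 = 0
        simp
      exact (TwoSidedIdeal.mem_ker _).1 (hle hf)
    · intro hf
      rw [hker] at hf
      have hdvd (m : Weight n k) : ∃ q : K[X], f.coeff m = (X - 1) * q := by
        have := dvd_iff_isRoot.2 (hf m)
        rwa [map_one] at this
      choose q hq using hdvd
      -- Dividing each coefficient by `X - 1` exhibits `f` itself as a generator, so no sums or
      -- products of generators are needed.
      refine TwoSidedIdeal.subset_span ⟨(q : Weight n k → K[X]), ?_⟩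
      exact funext fun m => (hq m).symm
  have hrel (f g : CombAlg n k K[X] X) :
      (f : CombAlgSpec n k K) = (g : CombAlgSpec n k K) ↔ ev f = ev g := by
    rw [RingCon.eq, TwoSidedIdeal.rel_iff, hmem, map_sub, sub_eq_zero]
  let φ : CombAlgSpec n k K → A := Quotient.lift ev fun f g h => (hrel f g).1 (Quotient.sound h)
  have hφ : Function.Bijective φ := by
    constructor
    · rintro ⟨f⟩ ⟨g⟩ h
      exact (hrel f g).2 h
    · intro a
      obtain ⟨f, rfl⟩ := hsurj a
      exact ⟨(f : CombAlgSpec n k K), rfl⟩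
  refine ⟨{ Equiv.ofBijective φ hφ with
    map_mul' := ?_
    map_add' := ?_ }, fun f => rfl⟩
  · rintro ⟨f⟩ ⟨g⟩
    exact map_mul ev f g
  · rintro ⟨f⟩ ⟨g⟩
    exact map_add ev f g

/-- Evaluation of the coefficients at `z = 1`, from the generic combinatorial algebra over a ring
mapping to `ℂ` to the Verlinde algebra. -/
noncomputable def specialise (hn : 2 ≤ n) {K : Type} [CommRing K] (ι : K →+* ℂ) :
    CombAlg n k K[X] X →ₙ+* VerlindeAlg n k where
  toFun f := fun m => ι ((f.coeff m).eval 1)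
  map_zero' := funext fun m => by
    change ι ((0 : K[X]).eval 1) = 0
    simp
  map_add' f g := funext fun m => by
    change ι ((f.coeff m + g.coeff m).eval 1) = ι ((f.coeff m).eval 1) + ι ((g.coeff m).eval 1)
    simp
  map_mul' f g := by
    have h1 := comp_combMul (n := n) (k := k) (ι.comp (evalRingHom 1)) X f g
    have h2 : ι.comp (evalRingHom 1) (X : K[X]) = 1 := by simp
    rw [h2, ← fusionMul_eq_combMul hn] at h1
    exact h1

theorem specialise_coeff (hn : 2 ≤ n) {K : Type} [CommRing K] (ι : K →+* ℂ)
    (f : CombAlg n k K[X] X) (m : Weight n k) :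
    (specialise hn ι f).coeff m = ι ((f.coeff m).eval 1) := rfl

theorem exists_specialise_eq (hn : 2 ≤ n) {K : Type} [CommRing K] (ι : K →+* ℂ)
    {v : VerlindeAlg n k} (hv : ∀ m, ∃ a, v.coeff m = ι a) : ∃ f, specialise hn ι f = v := by
  choose a ha using hv
  refine ⟨(fun m => C (a m) : Weight n k → K[X]), funext fun m => ?_⟩
  refine Eq.trans ?_ (ha m).symm
  change ι ((C (a m)).eval 1) = _
  rw [eval_C]

theorem specialise_eq_zero_iff (hn : 2 ≤ n) {K : Type} [CommRing K] {ι : K →+* ℂ}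
    (hι : Function.Injective ι) (f : CombAlg n k K[X] X) :
    specialise hn ι f = 0 ↔ ∀ m, (f.coeff m).eval 1 = 0 := by
  constructor
  · intro h m
    have : ι ((f.coeff m).eval 1) = 0 := congrFun h m
    exact (map_eq_zero_iff ι hι).1 this
  · intro h
    exact funext fun m => (map_eq_zero_iff ι hι).2 (h m)

end Specialisation

end AffineFusion

open AffineFusion in
theorem theorem5p8 (n k : ℕ) [NeZero n] (hn : 2 ≤ n) :
    -- the elementary polynomials commute, so that the Schur polynomials are well defined
    (∀ r s : ℤ, Commute (elem n k (Polynomial.X : Polynomial ℂ) r)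
      (elem n k (Polynomial.X : Polynomial ℂ) s)) ∧
    -- the generic combinatorial algebra is commutative and associative
    (∀ f g h : CombAlg n k (Polynomial ℂ) Polynomial.X,
      f * g = g * f ∧ f * g * h = f * (g * h)) ∧
    -- the weight `k ω̂₀` is the unit of the Verlinde algebra
    (∀ v : VerlindeAlg n k, VerlindeAlg.basis (Weight.zero n k) * v = v ∧
      v * VerlindeAlg.basis (Weight.zero n k) = v) ∧
    -- over `ℂ`: the specialisation at `z = 1` is the Verlinde algebra
    (∃ φ : CombAlgSpec n k ℂ ≃+* VerlindeAlg n k,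
      ∀ (f : CombAlg n k (Polynomial ℂ) Polynomial.X) (m : Weight n k),
        (φ (f : CombAlgSpec n k ℂ)).coeff m = (f.coeff m).eval 1) ∧
    -- over `ℤ`: the integral span of the weights is a subring of the Verlinde algebra, and it is
    -- the specialisation at `z = 1` of the integral combinatorial algebra
    (∃ F : NonUnitalSubring (VerlindeAlg n k),
      (∀ v : VerlindeAlg n k, v ∈ F ↔ ∀ m : Weight n k, ∃ a : ℤ, v.coeff m = a) ∧
      ∃ φ : CombAlgSpec n k ℤ ≃+* F,
        ∀ (f : CombAlg n k (Polynomial ℤ) Polynomial.X) (m : Weight n k),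
          (φ (f : CombAlgSpec n k ℤ) : VerlindeAlg n k).coeff m =
            (((f.coeff m).eval 1 : ℤ) : ℂ)) ∧
    -- at `z = 1`: the fusion product is given by the noncommutative Schur polynomials
    (∀ l m q : Weight n k,
      (VerlindeAlg.basis l * VerlindeAlg.basis m).coeff q =
        ((CombAlg.basis l * CombAlg.basis m : CombAlg n k ℂ 1)).coeff q ∧
      ((CombAlg.basis l * CombAlg.basis m : CombAlg n k ℂ 1)).coeff q =
        schur n k (1 : ℂ) l.affineDiagram (Pi.single m 1) q ∧
      schur n k (1 : ℂ) l.affineDiagram (Pi.single m 1) q =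
        schur n k (1 : ℂ) l.diagram (Pi.single m 1) q) := by
  refine ⟨commute_elem_X hn, fun f g h => ⟨combMul_X_comm hn f g, combMul_X_assoc hn f g h⟩,
    fusionMul_zero_weight, ?_, ?_, fun l m q => ⟨?_, ?_, ?_⟩⟩
  · obtain ⟨φ, hφ⟩ := exists_specialisation_ringEquiv (specialise (k := k) hn (RingHom.id ℂ))
      (fun v => exists_specialise_eq hn _ fun m => ⟨_, rfl⟩)
      (specialise_eq_zero_iff hn Function.injective_id)
    exact ⟨φ, fun f m => by rw [hφ, specialise_coeff]; rfl⟩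
  · refine ⟨NonUnitalRingHom.range (specialise (k := k) hn (Int.castRingHom ℂ)), fun v => ?_, ?_⟩
    · constructor
      · rintro ⟨f, rfl⟩ m
        exact ⟨_, rfl⟩
      · intro hv
        exact exists_specialise_eq hn (Int.castRingHom ℂ) hv
    · obtain ⟨φ, hφ⟩ := exists_specialisation_ringEquiv
        (specialise (k := k) hn (Int.castRingHom ℂ)).rangeRestrict
        (NonUnitalRingHom.rangeRestrict_surjective _) fun f => by
          rw [← specialise_eq_zero_iff hn (RingHom.injective_int (Int.castRingHom ℂ)), Subtype.ext_iff]
          rfl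
      exact ⟨φ, fun f m => congrArg (fun v : VerlindeAlg n k => v.coeff m)
        (congrArg Subtype.val (hφ f))⟩
  · exact congrFun (fusionMul_eq_combMul hn (Pi.single l 1) (Pi.single m 1)) q
  · change combMul n k (1 : ℂ) (Pi.single l 1) (Pi.single m 1) q = _
    have : combMul n k (1 : ℂ) (Pi.single l 1) = schur n k 1 l.affineDiagram := by
      refine LinearMap.ext fun v => ?_
      rw [combMul_apply, Finset.sum_eq_single l]
      · simp
      · intro p _ hp
        simp [hp]
      · exact fun h => absurd (Finset.mem_univ _) h
    rw [this]
  · rw [schur_affineDiagram_eq_diagram hn]
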